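/- **Conventions.** Let $n\ge 2$ and let $\mathbf A=(a_{ij})$ be the real $n\times n$ matrix of a linear operator $A:\mathbb R^n\to\mathbb R^n$. The *second compound matrix* $\mathbf A^{(2)}$ is the $\binom n2\times\binom n2$ matrix of all second-order minors of $\mathbf A$ with rows $i<j$ and columns $k<l$, the pairs being numbered lexicographically; $A\wedge A$ is the exterior square of $A$, acting on $\mathbb R^n\wedge\mathbb R^n$ by $(A\wedge A)(x\wedge y)=Ax\wedge Ay$. An $N\times N$ real matrix $\mathbf B=(b_{ij})$ is *$\mathcal J$-sign-symmetric*, with the set of indices $\mathcal J\subseteq\{1,\dots,N\}$, if $b_{ij}\le 0$ whenever exactly one of $i,j$ belongs to $\mathcal J$, and $b_{ij}<0$ only if exactly one of $i,j$ belongs to $\mathcal J$. A matrix is *irreducible* if no simultaneous permutation of its rows and columns brings it to the form $\begin{pmatrix}\mathbf B_1&0\\ \mathbf C&\mathbf B_2\end{pmatrix}$ with nonempty square blocks $\mathbf B_1,\mathbf B_2$; the $1\times1$ zero matrix counts as reducible. For a linear operator $B$ on a finite-dimensional real space, $\rho(B)$ is the largest modulus of its complex eigenvalues, and $h(B)$ is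 the number of eigenvalues of modulus $\rho(B)$, counted with multiplicity. An eigenvalue is *simple* if its algebraic multiplicity is $1$. For $\mathcal J\subseteq\{1,\dots,n\}$ and $\widetilde{\mathcal J}\subseteq\{1,\dots,\binom n2\}$ let $\widehat W(\mathcal J,\widetilde{\mathcal J})$ be the set of all pairs $(i,j)\in\{1,\dots,n\}^2$ such that $i=j$ or one of the following holds: (a) $i<j$, the indices $i,j$ both belong to $\mathcal J$ or both do not, and the number of $(i,j)$ belongs to $\widetilde{\mathcal J}$; (b) $i<j$, exactly one of $i,j$ belongs to $\mathcal J$, and the number of $(i,j)$ does not belong to $\widetilde{\mathcal J}$; (c) $i>j$, the indices $i,j$ both belong to $\mathcal J$ or both do not, and the number of $(j,i)$ does not belong to $\widetilde{\mathcal J}$; (d) $i>j$, exactly one of $i,j$ belongs to $\mathcal J$, and the number of $(j,i)$ belongs to $\widetilde{\mathcal J}$. The set $\widehat W$ is called *transitive* if the relation $i\prec j\iff(i,j)\in\widehat W$ is a linear order on $\{1,\dots,n\}$. **Theorem 15.** Let $\mathbf A$ be irreducible and $\mathcal J$-sign-symmetric with the set $\mathcal J$, and let $\mathbf A^{(2)}$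 be irreducible and $\mathcal J$-sign-symmetric with the set $\widetilde{\mathcal J}$. 1. If $\widehat W(\mathcal J,\widetilde{\mathcal J})$ is transitive, then $h(A)=1$, and the eigenvalues of $A$, repeated according to multiplicity and suitably numbered, satisfy $$\rho(A)=\lambda_1>\lambda_2\ge|\lambda_3|\ge\dots\ge|\lambda_n|,$$ where $\lambda_1,\lambda_2$ are positive simple eigenvalues. If moreover $h(A\wedge A)=1$, then $\lambda_2$ differs in modulus from all the other eigenvalues. If moreover $h=h(A\wedge A)>1$, then $A$ has exactly $h$ eigenvalues of modulus $\lambda_2$, namely $\lambda_2,\dots,\lambda_{h+1}$; each of them is simple, and together they are exactly the $h$-th roots of $\lambda_2^{\,h}$. 2. If $\widehat W(\mathcal J,\widetilde{\mathcal J})$ is not transitive, then $h(A)=h(A\wedge A)=3$; there are exactly three eigenvalues of $A$ on the circle $|\lambda|=\rho(A)$, each of them is simple, and they are exactly the three cube roots of $\rho(A)^3$. -/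

import Mathlib

noncomputable section

/-- The ordered pairs of indices `i < j`, which number the rows and the columns of the second
compound matrix (the `C(n,2)` pairs themselves stand for their lexicographic numbers). -/
abbrev IndexPair (n : ℕ) : Type := {p : Fin n × Fin n // p.1 < p.2}

/-- The second compound matrix: its entries are the minors of order two with the rows `i < j` and
the columns `k < l`. -/
def secondCompound {n : ℕ} (A : Matrix (Fin n) (Fin n) ℝ) :
    Matrix (IndexPair n) (IndexPair n) ℝ :=
  fun p q => (A.submatrix ![p.1.1, p.1.2] ![q.1.1, q.1.2]).det

/-- The exterior square `A ∧ A` of the operator `A` on `ℝⁿ`,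
`(A ∧ A) (x ∧ y) = A x ∧ A y`. -/
def exteriorSquare {n : ℕ} (A : (Fin n → ℝ) →ₗ[ℝ] (Fin n → ℝ)) :
    ⋀[ℝ]^2 (Fin n → ℝ) →ₗ[ℝ] ⋀[ℝ]^2 (Fin n → ℝ) :=
  exteriorPower.map 2 A

/-- `A` is `𝒥`-sign-symmetric with the set of indices `J`: the entries with exactly one index in
`J` are nonpositive, and only such entries can be negative. -/
def JSignSymmetric {ι : Type*} (A : Matrix ι ι ℝ) (J : Set ι) : Prop :=
  (∀ i j, Xor (i ∈ J) (j ∈ J) → A i j ≤ 0) ∧ (∀ i j, A i j < 0 → Xor (i ∈ J) (j ∈ J))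

/-- Irreducibility: no permutation of the coordinates gives a block triangular form, i.e. there
is no nonempty proper set `S` of indices with a zero block of rows in `S` and columns outside `S`.
For matrices of size at least two this implies `A ≠ 0`; the condition `A ≠ 0` says that the
`1 × 1` zero matrix and the empty matrix are not irreducible. -/
def IrreducibleMatrix {ι : Type*} (A : Matrix ι ι ℝ) : Prop :=
  A ≠ 0 ∧ ∀ S : Set ι, S.Nonempty → S ≠ Set.univ → ∃ i ∈ S, ∃ j ∉ S, A i j ≠ 0

/-- The set `Ŵ(𝒥, 𝒥̃)` of pairs of indices (it contains the diagonal). -/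
def WHat {n : ℕ} (J : Set (Fin n)) (J' : Set (IndexPair n)) : Set (Fin n × Fin n) :=
  {p | p.1 = p.2 ∨
    (∃ h : p.1 < p.2, (p.1 ∈ J ↔ p.2 ∈ J) ∧ (⟨(p.1, p.2), h⟩ : IndexPair n) ∈ J') ∨
    (∃ h : p.1 < p.2, Xor (p.1 ∈ J) (p.2 ∈ J) ∧ (⟨(p.1, p.2), h⟩ : IndexPair n) ∉ J') ∨
    (∃ h : p.2 < p.1, (p.1 ∈ J ↔ p.2 ∈ J) ∧ (⟨(p.2, p.1), h⟩ : IndexPair n) ∉ J') ∨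
    (∃ h : p.2 < p.1, Xor (p.1 ∈ J) (p.2 ∈ J) ∧ (⟨(p.2, p.1), h⟩ : IndexPair n) ∈ J')}

/-- A set `W` of pairs is called transitive if the binary relation that it defines is a linear
order: reflexive, antisymmetric, transitive and connected. -/
def TransitiveSet {α : Type*} (W : Set (α × α)) : Prop :=
  (∀ i, (i, i) ∈ W) ∧
  (∀ i j, (i, j) ∈ W → (j, i) ∈ W → i = j) ∧
  (∀ i j k, (i, j) ∈ W → (j, k) ∈ W → (i, k) ∈ W) ∧
  (∀ i j, (i, j) ∈ W ∨ (j, i) ∈ W)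

section Operators

variable {V : Type*} [AddCommGroup V] [Module ℝ V] [Module.Finite ℝ V] [Module.Free ℝ V]

/-- The complex eigenvalues of a real operator, repeated according to (algebraic) multiplicity. -/
def eigenvaluesOf (f : V →ₗ[ℝ] V) : Multiset ℂ :=
  f.charpoly.aroots ℂ

/-- The spectral radius `ρ(f)`: the largest modulus of an eigenvalue. -/
def rho (f : V →ₗ[ℝ] V) : ℝ :=
  sSup {r : ℝ | ∃ z ∈ eigenvaluesOf f, r = ‖z‖}

/-- The index of imprimitivity `h(f)`: the number of the eigenvalues, counted with
multiplicity, whose modulus is `ρ(f)`. -/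
def imprimitivityIndex (f : V →ₗ[ℝ] V) : ℕ :=
  ((eigenvaluesOf f).filter (fun z => ‖z‖ = rho f)).card

/-- `z` is a simple eigenvalue of `f`. -/
def IsSimpleEigenvalue (f : V →ₗ[ℝ] V) (z : ℂ) : Prop :=
  (eigenvaluesOf f).count z = 1

end Operators

end

/-! Conjugation by a diagonal matrix of signs makes `A` and its second compound nonnegative, so
Perron–Frobenius applies to both: the peripheral eigenvalues are simple and are the `h`-th roots of
`ρ ^ h`, and the Perron vectors `u` and `y` have the signs of `J` and `J'`. The eigenvalues of `A ∧
A` are the products of two eigenvalues of `A` with distinct indices.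

If `h(A) = m > 1`, the peripheral products have modulus `ρ(A)²`. For `m = 2` the number `ρ(A)²`
itself is not such a product; for `m ≥ 4` the coincidence `1 · ω³ = ω · ω²` contradicts simplicity.
Hence `m` is 1 or 3, and `m = 3` forces `h(A ∧ A) = 3` (`card_filter_eq_one_or_three`). For `m = 1`
the peripheral eigenvalues of `A ∧ A` are `ρ(A) λ` with `|λ| = λ₂`, and division by `ρ(A)` describes
the second circle (`second_eigenvalue`).

The order `Ŵ` decides between the two cases. If `m = 1` and `A v = λ₂ v`, then `u ∧ v` is a nonzero
multiple of `y`; its signs say that `Ŵ` orders the indices by the ratios `v i / u i`, so `Ŵ` is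
linear. Conversely, if `Ŵ` is linear with first element `o`, the signs of the minors containing `o`
and irreducibility force `A o o > 0`, and a positive diagonal entry forces `m = 1`. -/

/-! ### Sums over pairs of indices. -/

section PairSums

open Finset

/-- A sum over all ordered pairs splits into the diagonal and the pairs `i < j`, taken twice. -/
theorem sum_sum_eq_sum_diag_add_sum_indexPair {n : ℕ} {M : Type*} [AddCommMonoid M]
    (g : Fin n → Fin n → M) :
    ∑ i, ∑ j, g i j =
      ∑ i, g i i + ∑ p : IndexPair n, (g p.1.1 p.1.2 + g p.1.2 p.1.1) := by
  have hlt : ∑ x : Fin n × Fin n with x.1 < x.2, g x.1 x.2 =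
      ∑ p : IndexPair n, g p.1.1 p.1.2 :=
    Finset.sum_subtype _ (by simp) (fun x : Fin n × Fin n => g x.1 x.2)
  have hgt : ∑ x : Fin n × Fin n with x.2 < x.1, g x.1 x.2 =
      ∑ p : IndexPair n, g p.1.2 p.1.1 := by
    rw [← Finset.sum_subtype (univ.filter fun x : Fin n × Fin n => x.1 < x.2) (by simp)
      (fun x : Fin n × Fin n => g x.2 x.1)]
    exact Finset.sum_equiv (Equiv.prodComm _ _) (by simp) (by simp)
  have heq : ∑ x : Fin n × Fin n with x.1 = x.2, g x.1 x.2 = ∑ i, g i i := by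
    symm
    refine Finset.sum_bij (fun i _ => (i, i)) (by simp) (by simp) ?_ (by simp)
    rintro ⟨i, j⟩ h
    simp only [mem_filter, mem_univ, true_and] at h
    subst h
    exact ⟨i, mem_univ _, rfl⟩
  rw [← Finset.sum_product' univ univ g, univ_product_univ, Finset.sum_add_distrib, ← hlt, ← hgt,
    ← heq, ← Finset.sum_filter_add_sum_filter_not univ (fun x : Fin n × Fin n => x.1 = x.2)]
  congr 1
  rw [← Finset.sum_filter_add_sum_filter_not _ (fun x : Fin n × Fin n => x.1 < x.2)]
  congr 1 <;> rw [Finset.filter_filter] <;> congr 1 <;> ext x <;>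
    simp only [mem_filter, mem_univ, true_and]
  · exact ⟨fun h => h.2, fun h => ⟨h.ne, h⟩⟩
  · exact ⟨fun h => lt_of_le_of_ne (not_lt.mp h.2) (Ne.symm h.1), fun h => ⟨h.ne', h.not_gt⟩⟩

/-- The Lagrange–Binet–Cauchy identity. -/
theorem sum_indexPair_minor_mul_minor {n : ℕ} {R : Type*} [CommRing R] (a b x y : Fin n → R) :
    ∑ p : IndexPair n, (a p.1.1 * b p.1.2 - a p.1.2 * b p.1.1) *
        (x p.1.1 * y p.1.2 - x p.1.2 * y p.1.1) =
      (∑ i, a i * x i) * (∑ i, b i * y i) - (∑ i, a i * y i) * (∑ i, b i * x i) := by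
  rw [Finset.sum_mul_sum, Finset.sum_mul_sum, ← Finset.sum_sub_distrib]
  simp_rw [← Finset.sum_sub_distrib]
  rw [sum_sum_eq_sum_diag_add_sum_indexPair,
    Finset.sum_eq_zero (s := univ) (f := fun i => a i * x i * (b i * y i) - _)
      (fun i _ => by ring), zero_add]
  exact Finset.sum_congr rfl fun p _ => by ring

/-- The multiset of the products of pairs of members of a finite family does not depend on the
numbering of the family. -/
theorem map_mul_indexPair_eq_of_map_eq {n : ℕ} {R : Type*} [CommMonoid R] (s t : Fin n → R)
    (h : (univ : Finset (Fin n)).val.map s = (univ : Finset (Fin n)).val.map t) :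
    (univ : Finset (IndexPair n)).val.map (fun p => s p.1.1 * s p.1.2) =
      (univ : Finset (IndexPair n)).val.map (fun p => t p.1.1 * t p.1.2) := by
  classical
  -- The sums over all ordered pairs and over the diagonal depend only on the multiset of values;
  -- they differ by twice the multiset sought, and the factor 2 cancels in multiplicities.
  have key : ∀ f : Fin n → R,
      (((univ : Finset (Fin n)).val.map f).map fun x =>
        (((univ : Finset (Fin n)).val.map f).map fun y => ({x * y} : Multiset R)).sum).sum =
      (((univ : Finset (Fin n)).val.map f).map fun x => ({x * x} : Multiset R)).sum +
      2 • (univ : Finset (IndexPair n)).val.map (fun p => f p.1.1 * f p.1.2) := by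
    intro f
    have h2 : (univ : Finset (IndexPair n)).val.map (fun p => f p.1.1 * f p.1.2) =
        ∑ p : IndexPair n, {f p.1.1 * f p.1.2} := by
      exact (by simpa [Multiset.map_map, Function.comp_def] using (Multiset.sum_map_singleton ((univ : Finset (IndexPair n)).val.map fun p => f p.1.1 * f p.1.2)).symm)
    simp only [Multiset.map_map, Function.comp_def]
    rw [h2, two_nsmul, ← Finset.sum_add_distrib]
    refine (sum_sum_eq_sum_diag_add_sum_indexPair (fun i j => ({f i * f j} : Multiset R))).trans ?_
    congr 1
    exact Finset.sum_congr rfl fun p _ => by rw [mul_comm (f p.1.2)]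
  have h1 := key s
  rw [h, key t] at h1
  have h2 := add_left_cancel h1
  ext r
  have h3 := congrArg (Multiset.count r) h2
  simp only [Multiset.count_nsmul] at h3
  omega

end PairSums

/-! ### The second compound, its spectrum, and the exterior square. -/

section Compound

open Matrix Module

variable {n : ℕ} {R : Type*} [CommRing R]

/-- The second compound of a matrix over a commutative ring. -/
def Matrix.compoundTwo (A : Matrix (Fin n) (Fin n) R) : Matrix (IndexPair n) (IndexPair n) R :=
  Matrix.of fun p q => A p.1.1 q.1.1 * A p.1.2 q.1.2 - A p.1.1 q.1.2 * A p.1.2 q.1.1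

theorem secondCompound_apply (A : Matrix (Fin n) (Fin n) ℝ) (p q : IndexPair n) :
    secondCompound A p q = A p.1.1 q.1.1 * A p.1.2 q.1.2 - A p.1.1 q.1.2 * A p.1.2 q.1.1 := by
  simp only [secondCompound, Matrix.det_fin_two]
  rfl

theorem secondCompound_eq_compoundTwo (A : Matrix (Fin n) (Fin n) ℝ) :
    secondCompound A = A.compoundTwo := by
  ext p q
  rw [secondCompound_apply]
  rfl

namespace Matrix

theorem compoundTwo_map {S : Type*} [CommRing S] (f : R →+* S) (A : Matrix (Fin n) (Fin n) R) :
    (A.map f).compoundTwo = A.compoundTwo.map f := by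
  ext p q
  simp [compoundTwo]

/-- Cauchy–Binet: each entry is the Lagrange identity for two rows of `A` and two columns of `B`.
Similar matrices therefore have similar compounds. -/
theorem compoundTwo_mul (A B : Matrix (Fin n) (Fin n) R) :
    (A * B).compoundTwo = A.compoundTwo * B.compoundTwo := by
  ext p q
  have := sum_indexPair_minor_mul_minor (A p.1.1) (A p.1.2) (fun k => B k q.1.1)
    (fun k => B k q.1.2)
  simp only [compoundTwo, of_apply, Matrix.mul_apply]
  rw [← this]
  exact Finset.sum_congr rfl fun r _ => by ring

theorem compoundTwo_one : (1 : Matrix (Fin n) (Fin n) R).compoundTwo = 1 := by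
  ext p q
  obtain ⟨⟨i, j⟩, hij⟩ := p
  obtain ⟨⟨k, l⟩, hkl⟩ := q
  simp only at hij hkl
  simp only [compoundTwo, of_apply, one_apply, Subtype.mk.injEq, Prod.mk.injEq]
  split_ifs <;> grind

/-- The second compound applied to the coordinates of a bivector `x ∧ y`. -/
theorem compoundTwo_mulVec (A : Matrix (Fin n) (Fin n) R) (x y : Fin n → R) :
    A.compoundTwo *ᵥ (fun p => x p.1.1 * y p.1.2 - x p.1.2 * y p.1.1) =
      fun p => (A *ᵥ x) p.1.1 * (A *ᵥ y) p.1.2 - (A *ᵥ x) p.1.2 * (A *ᵥ y) p.1.1 := by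
  ext p
  have := sum_indexPair_minor_mul_minor (A p.1.1) (A p.1.2) x y
  simp only [compoundTwo, of_apply, Matrix.mulVec, dotProduct]
  rw [mul_comm (∑ i, A p.1.2 i * x i), ← this]

end Matrix

/-- Over an algebraically closed field every operator has a lower triangular matrix in some
basis. -/
theorem Module.End.exists_basis_lowerTriangular {K : Type*} [Field K] [IsAlgClosed K] :
    ∀ (n : ℕ) {V : Type*} [AddCommGroup V] [Module K V] [FiniteDimensional K V]
      (_ : finrank K V = n) (f : End K V),
      ∃ (b : Basis (Fin n) K V) (T : Matrix (Fin n) (Fin n) K),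
        (∀ i j, i < j → T i j = 0) ∧ ∀ j, f (b j) = ∑ i, T i j • b i := by
  intro n
  induction n with
  | zero =>
    intro V _ _ _ hV f
    exact ⟨finBasisOfFinrankEq K V hV, 0, fun i => i.elim0, fun i => i.elim0⟩
  | succ n ih =>
    intro V _ _ _ hV f
    have : Nontrivial V := nontrivial_of_finrank_pos (R := K) (by omega)
    -- An eigenvector of the transpose is a functional with an invariant kernel. Induction applies
    -- to this hyperplane, and a complementary vector placed first keeps the matrix lower
    -- triangular.
    obtain ⟨c, hc⟩ := Module.End.exists_eigenvalue (K := K) (V := Dual K V) (Dual.transpose f)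
    obtain ⟨φ, hφ⟩ := hc.exists_hasEigenvector
    have hφf : ∀ x, φ (f x) = c * φ x := fun x => by
      have := LinearMap.congr_fun hφ.apply_eq_smul x
      rwa [Dual.transpose_apply, LinearMap.comp_apply] at this
    have hφ0 : φ ≠ 0 := hφ.2
    obtain ⟨y, hy⟩ : ∃ y, φ y ≠ 0 := by
      by_contra! h
      exact hφ0 (LinearMap.ext h)
    let N := LinearMap.ker φ
    have hN : finrank K N = n := by
      have h : finrank K N + 1 = finrank K V := Module.Dual.finrank_ker_add_one_of_ne_zero hφ0
      omega
    have hfN : ∀ x ∈ N, f x ∈ N := fun x hx => by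
      have hx' : φ x = 0 := hx
      change φ (f x) = 0
      rw [hφf, hx', mul_zero]
    obtain ⟨b', T', hT', hb'⟩ := ih hN (f.restrict hfN)
    let b : Basis (Fin (n + 1)) K V := Basis.mkFinCons y b'
      (fun d x hx h => by
        have hx' : φ x = 0 := hx
        have := congrArg φ h
        simpa [hx', hy] using this)
      (fun z => ⟨-(φ z / φ y), by
        change φ _ = 0
        simp [hy]⟩)
    have hb : (b : Fin (n + 1) → V) = Fin.cons y ((↑) ∘ b') := Basis.coe_mkFinCons _ _ _ _
    refine ⟨b, Matrix.of fun i j => Fin.cases (b.repr (f y) i)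
      (fun j => Fin.cases 0 (fun i => T' i j) i) j, ?_, ?_⟩
    · intro i j hij
      induction j using Fin.cases with
      | zero => simp at hij
      | succ j =>
        induction i using Fin.cases with
        | zero => simp
        | succ i => simpa using hT' i j (by simpa using hij)
    · intro j
      induction j using Fin.cases with
      | zero =>
        have hb0 : b 0 = y := by rw [hb]; rfl
        simp only [Matrix.of_apply, Fin.cases_zero, hb0]
        exact (b.sum_repr (f y)).symm
      | succ j =>
        have h := congrArg (Subtype.val) (hb' j)
        simp only [LinearMap.coe_restrict_apply, Submodule.coe_sum, Submodule.coe_smul] at h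
        rw [Fin.sum_univ_succ]
        simp [hb, h]

/-- Every complex matrix is similar to a lower triangular one. -/
theorem Matrix.exists_eq_mul_lowerTriangular_mul {K : Type*} [Field K] [IsAlgClosed K]
    (A : Matrix (Fin n) (Fin n) K) :
    ∃ P T Q : Matrix (Fin n) (Fin n) K, A = P * T * Q ∧ Q * P = 1 ∧ P * Q = 1 ∧
      ∀ i j, i < j → T i j = 0 := by
  obtain ⟨b, T, hT, hb⟩ := Module.End.exists_basis_lowerTriangular (K := K) n
    (V := Fin n → K) (by simp) (Matrix.toLin' A)
  let e := Pi.basisFun K (Fin n)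
  have hPQ : e.toMatrix b * b.toMatrix e = 1 := Basis.toMatrix_mul_toMatrix_flip _ _
  have hQP : b.toMatrix e * e.toMatrix b = 1 := Basis.toMatrix_mul_toMatrix_flip _ _
  have hAP : A * e.toMatrix b = e.toMatrix b * T := by
    ext i j
    have := congrFun (hb j) i
    simp only [Matrix.toLin'_apply, Finset.sum_apply, Pi.smul_apply, smul_eq_mul] at this
    simp only [Matrix.mul_apply, Basis.toMatrix_apply, e, Pi.basisFun_repr]
    rw [Matrix.mulVec, dotProduct] at this
    rw [this]
    exact Finset.sum_congr rfl fun k _ => mul_comm _ _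
  exact ⟨_, T, _, by rw [← hAP, Matrix.mul_assoc, hPQ, Matrix.mul_one], hQP, hPQ, hT⟩

-- The order is pulled back along `b`, so that pairs of indices can be ordered lexicographically.
open Polynomial in
theorem Matrix.charpoly_of_lowerTriangular {ι : Type*} [Fintype ι] [DecidableEq ι]
    {α : Type*} [LinearOrder α] (b : ι → α) (hb : Function.Injective b)
    (T : Matrix ι ι R) (h : ∀ i j, b i < b j → T i j = 0) :
    T.charpoly = ∏ i, (X - C (T i i)) := by
  rw [← Matrix.charpoly_transpose]
  let _ : LinearOrder ι := LinearOrder.lift' b hb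
  have : Tᵀ.IsUpperTriangular := fun i j hij => h j i hij
  convert Matrix.charpoly_of_isUpperTriangular Tᵀ this using 2
  simp

/-- The roots of the characteristic polynomials of a complex matrix and of its second
compound. -/
theorem Matrix.exists_charpoly_roots_compoundTwo (A : Matrix (Fin n) (Fin n) ℂ) :
    ∃ t : Fin n → ℂ, A.charpoly.roots = Finset.univ.val.map t ∧
      A.compoundTwo.charpoly.roots =
        (Finset.univ : Finset (IndexPair n)).val.map (fun p => t p.1.1 * t p.1.2) := by
  obtain ⟨P, T, Q, hA, hQP, hPQ, hT⟩ := A.exists_eq_mul_lowerTriangular_mul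
  refine ⟨fun i => T i i, ?_, ?_⟩
  · have : A.charpoly = T.charpoly := by
      rw [hA, Matrix.mul_assoc, Matrix.charpoly_mul_comm, Matrix.mul_assoc, hQP, Matrix.mul_one]
    rw [this, Matrix.charpoly_of_lowerTriangular id Function.injective_id T hT]
    exact Polynomial.roots_multiset_prod_X_sub_C (Finset.univ.val.map fun i => T i i) ▸ by
      rw [Multiset.map_map]; rfl
  · have : A.compoundTwo.charpoly = T.compoundTwo.charpoly := by
      rw [hA, compoundTwo_mul, compoundTwo_mul, Matrix.mul_assoc, Matrix.charpoly_mul_comm,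
        Matrix.mul_assoc, ← compoundTwo_mul, hQP, compoundTwo_one, Matrix.mul_one]
    have hd : ∀ p : IndexPair n, T.compoundTwo p p = T p.1.1 p.1.1 * T p.1.2 p.1.2 := fun p => by
      simp [compoundTwo, hT _ _ p.2]
    rw [this, Matrix.charpoly_of_lowerTriangular (fun p : IndexPair n => toLex p.1)
      (fun p q h => Subtype.ext (toLex.injective h))]
    · simp_rw [hd]
      exact Polynomial.roots_multiset_prod_X_sub_C
        (Finset.univ.val.map fun p : IndexPair n => T p.1.1 p.1.1 * T p.1.2 p.1.2) ▸ by
          rw [Multiset.map_map]; rfl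
    -- Either row `i` vanishes in the columns `k` and `l`, or `i = k` and column `l` vanishes in the
    -- rows `i` and `j`.
    · rintro ⟨⟨i, j⟩, hij⟩ ⟨⟨k, l⟩, hkl⟩ h
      simp only at hij hkl
      simp only [compoundTwo, of_apply]
      rw [Prod.Lex.toLex_lt_toLex] at h
      rcases h with h | ⟨h, h'⟩
      · simp only at h
        rw [hT i k h, hT i l (h.trans hkl)]
        ring
      · simp only at h h'
        subst h
        rw [hT j l h', hT i l hkl]
        ring

/-- The pairs `i < j` are the subsets with two elements. -/
def indexPairEquiv (n : ℕ) : Set.powersetCard (Fin n) 2 ≃ IndexPair n :=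
  Set.powersetCard.ofFinEmbEquiv.symm.trans
    { toFun := fun f => ⟨(f 0, f 1), f.strictMono (by decide)⟩
      invFun := fun p => OrderEmbedding.ofStrictMono ![p.1.1, p.1.2] (by
        intro a b hab
        fin_cases a <;> fin_cases b <;> simp_all [p.2])
      left_inv := fun f => by
        ext a
        fin_cases a <;> rfl
      right_inv := fun p => rfl }

/-- In the basis `e_i ∧ e_j` the matrix of `A ∧ A` is the second compound. -/
theorem charpoly_exteriorSquare (A : Matrix (Fin n) (Fin n) ℝ) :
    (exteriorSquare (Matrix.toLin' A)).charpoly = (secondCompound A).charpoly := by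
  let e := Pi.basisFun ℝ (Fin n)
  rw [← LinearMap.charpoly_toMatrix _ ((e.exteriorPower 2).reindex (indexPairEquiv n))]
  congr 1
  ext p q
  rw [LinearMap.toMatrix_apply, secondCompound_apply, Basis.reindex_apply, Basis.repr_reindex_apply,
    exteriorPower.basis_repr_apply, exteriorPower.basis_apply, exteriorSquare,
    exteriorPower.map_apply_ιMulti_family, exteriorPower.ιMulti_family,
    exteriorPower.ιMultiDual_apply_ιMulti, Matrix.det_fin_two]
  have h : ∀ r : IndexPair n,
      Set.powersetCard.ofFinEmbEquiv.symm ((indexPairEquiv n).symm r) 0 = r.1.1 ∧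
      Set.powersetCard.ofFinEmbEquiv.symm ((indexPairEquiv n).symm r) 1 = r.1.2 := by
    intro r
    have := congrArg Subtype.val ((indexPairEquiv n).apply_symm_apply r)
    exact ⟨congrArg Prod.fst this, congrArg Prod.snd this⟩
  simp [e, (h p).1, (h p).2, (h q).1, (h q).2, mul_comm]

end Compound

/-! ### Perron–Frobenius theory of irreducible nonnegative matrices. -/

section PerronFrobenius

open Matrix Module Finset

/-- The multiset `M` of eigenvalues has the peripheral structure of the spectrum of an irreducible
nonnegative matrix with the spectral radius `r`: the eigenvalues of the largest modulus `r` are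
simple, and they are the `h`-th roots of `r ^ h`, where `h` is their number. -/
structure IsPeripherallyCyclic (M : Multiset ℂ) (r : ℝ) : Prop where
  pos : 0 < r
  norm_le : ∀ z ∈ M, ‖z‖ ≤ r
  count_eq_one : ∀ z ∈ M, ‖z‖ = r → M.count z = 1
  mem_iff : ∀ z, (z ∈ M ∧ ‖z‖ = r) ↔
    z ^ (M.filter fun w => ‖w‖ = r).card = (r : ℂ) ^ (M.filter fun w => ‖w‖ = r).card

/-- For peripheral `z` the map `w ↦ z * w / r` permutes the finite set of peripheral eigenvalues.
Comparing the products of all its `h` elements gives `z ^ h = r ^ h`, and `h` distinct solutions of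
this equation are all of them. -/
theorem IsPeripherallyCyclic.of_mul_mem {M : Multiset ℂ} {r : ℝ} (hr : 0 < r)
    (hle : ∀ z ∈ M, ‖z‖ ≤ r) (h1 : ∀ z ∈ M, ‖z‖ = r → M.count z = 1) (hrM : (r : ℂ) ∈ M)
    (hmul : ∀ z ∈ M, ‖z‖ = r → ∀ w ∈ M, z * w / r ∈ M) :
    IsPeripherallyCyclic M r := by
  classical
  refine ⟨hr, hle, h1, ?_⟩
  have hr0 : (r : ℂ) ≠ 0 := by exact_mod_cast hr.ne'
  set N := M.filter fun w => ‖w‖ = r with hN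
  have hmemN : ∀ z, z ∈ N ↔ z ∈ M ∧ ‖z‖ = r := fun z => Multiset.mem_filter
  have hnodup : N.Nodup := by
    rw [Multiset.nodup_iff_count_le_one]
    intro z
    by_cases hz : z ∈ N
    · have := (hmemN z).1 hz
      rw [hN, Multiset.count_filter_of_pos (p := fun w : ℂ => ‖w‖ = r) this.2]
      exact (h1 z this.1 this.2).le
    · rw [Multiset.count_eq_zero_of_notMem hz]
      exact Nat.zero_le _
  let F : Finset ℂ := ⟨N, hnodup⟩
  have hF : ∀ z, z ∈ F ↔ z ∈ M ∧ ‖z‖ = r := hmemN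
  have hcard : F.card = N.card := rfl
  have hrF : (r : ℂ) ∈ F := (hF _).2 ⟨hrM, by simp [hr.le]⟩
  have hpos : 0 < F.card := Finset.card_pos.2 ⟨_, hrF⟩
  have hne : ∀ z ∈ F, z ≠ 0 := fun z hz h0 => by
    have := ((hF z).1 hz).2
    rw [h0, norm_zero] at this
    exact hr.ne this
  have hroot : ∀ z ∈ F, z ^ F.card = (r : ℂ) ^ F.card := by
    intro z hz
    have hz' := (hF z).1 hz
    have hinj : Set.InjOn (fun w => z * w / r) F := by
      intro w _ w' _ h
      have h' : z * w / r = z * w' / r := h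
      field_simp at h'
      exact mul_left_cancel₀ (hne z hz) h'
    have himg : F.image (fun w => z * w / r) = F := by
      apply Finset.eq_of_subset_of_card_le
      · intro y hy
        obtain ⟨w, hw, rfl⟩ := Finset.mem_image.1 hy
        have hw' := (hF w).1 hw
        refine (hF _).2 ⟨hmul z hz'.1 hz'.2 w hw'.1, ?_⟩
        simp [hz'.2, hw'.2, abs_of_pos hr, hr.ne']
      · rw [Finset.card_image_of_injOn hinj]
    have hprod : ∏ w ∈ F, (z * w / r) = ∏ w ∈ F, w := by
      rw [← Finset.prod_image (f := fun w => w) hinj, himg]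
    rw [Finset.prod_div_distrib, Finset.prod_mul_distrib, Finset.prod_const, Finset.prod_const,
      div_eq_iff (pow_ne_zero _ hr0), mul_comm] at hprod
    exact mul_left_cancel₀ (Finset.prod_ne_zero_iff.2 hne) hprod
  have hsub : F ⊆ (Polynomial.nthRoots F.card ((r : ℂ) ^ F.card)).toFinset := fun z hz => by
    rw [Multiset.mem_toFinset, Polynomial.mem_nthRoots hpos]
    exact hroot z hz
  have heq := Finset.eq_of_subset_of_card_le hsub
    ((Multiset.toFinset_card_le _).trans (Polynomial.card_nthRoots _ _))
  intro z
  rw [← hF z, ← hcard, ← Polynomial.mem_nthRoots hpos, ← Multiset.mem_toFinset, ← heq]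

variable {ι : Type*}

theorem IrreducibleMatrix.transpose {B : Matrix ι ι ℝ} (hB : IrreducibleMatrix B) :
    IrreducibleMatrix Bᵀ := by
  refine ⟨fun h => hB.1 (by rw [← transpose_transpose B, h, transpose_zero]), fun S hS hS' => ?_⟩
  obtain ⟨i, hi, j, hj, hij⟩ := hB.2 Sᶜ (Set.nonempty_compl.2 hS')
    (fun h => hS.ne_empty (Set.compl_univ_iff.1 h))
  exact ⟨j, not_not.1 hj, i, hi, hij⟩

theorem Matrix.mulVec_nonneg_of_nonneg [Fintype ι] {B : Matrix ι ι ℝ} (h0 : ∀ i j, 0 ≤ B i j)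
    {x : ι → ℝ} (hx : ∀ i, 0 ≤ x i) (i : ι) : 0 ≤ (B *ᵥ x) i :=
  Finset.sum_nonneg fun j _ => mul_nonneg (h0 i j) (hx j)

variable [Fintype ι]

/-- If `B` is irreducible and nonnegative, then a power of `1 + B` maps the nonzero nonnegative
vectors to positive ones. -/
theorem IrreducibleMatrix.one_add_pow_mulVec_pos [DecidableEq ι] {B : Matrix ι ι ℝ} (hB : IrreducibleMatrix B)
    (h0 : ∀ i j, 0 ≤ B i j) {x : ι → ℝ} (hx : ∀ i, 0 ≤ x i) (hx0 : x ≠ 0) (i : ι) :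
    0 < ((1 + B) ^ Fintype.card ι *ᵥ x) i := by
  -- Induction on the number of zero coordinates: `1 + B` keeps the positive coordinates and, by
  -- irreducibility, makes some zero coordinate positive while one remains.
  suffices H : ∀ (k : ℕ) (x : ι → ℝ), (∀ i, 0 ≤ x i) → x ≠ 0 →
      (univ.filter fun i => x i = 0).card ≤ k → ∀ i, 0 < ((1 + B) ^ k *ᵥ x) i from
    H _ x hx hx0 (Finset.card_le_univ _) i
  clear hx hx0 i x
  intro k
  induction k with
  | zero =>
    intro x hx _ hc i
    rw [pow_zero, one_mulVec]
    refine lt_of_le_of_ne (hx i) fun h => ?_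
    have : i ∈ univ.filter fun i => x i = 0 := by simp [h.symm]
    rw [Finset.card_eq_zero.1 (Nat.le_zero.1 hc)] at this
    simp at this
  | succ k ih =>
    intro x hx hx0 hc i
    rw [pow_succ, ← mulVec_mulVec]
    have hBx := Matrix.mulVec_nonneg_of_nonneg h0 hx
    have hy : ∀ i, ((1 + B) *ᵥ x) i = x i + (B *ᵥ x) i := fun i => by
      rw [add_mulVec, one_mulVec, Pi.add_apply]
    obtain ⟨l, hl⟩ := Function.ne_iff.1 hx0
    have hl' : 0 < x l := lt_of_le_of_ne (hx l) (Ne.symm hl)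
    refine ih _ (fun i => by rw [hy]; exact add_nonneg (hx i) (hBx i)) ?_ ?_ i
    · intro h
      have := congrFun h l
      rw [hy, Pi.zero_apply] at this
      linarith [hBx l]
    · rcases (univ.filter fun i => x i = 0).eq_empty_or_nonempty with he | ⟨m, hm⟩
      · have : (univ.filter fun i => ((1 + B) *ᵥ x) i = 0) = ∅ := by
          refine Finset.filter_eq_empty_iff.2 fun i _ h => ?_
          have hi := Finset.filter_eq_empty_iff.1 he (mem_univ i)
          have : 0 < x i := lt_of_le_of_ne (hx i) (Ne.symm hi)
          rw [hy] at h
          linarith [hBx i]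
        rw [this]
        simp
      · obtain ⟨a, ha, b, hb, hab⟩ := hB.2 {i | x i = 0} ⟨m, (mem_filter.1 hm).2⟩ (fun h => by
          have : l ∈ {i | x i = 0} := h ▸ Set.mem_univ l
          exact hl this)
        refine Nat.le_of_lt_succ (lt_of_lt_of_le (Finset.card_lt_card ?_) hc)
        rw [Finset.ssubset_iff_of_subset]
        · refine ⟨a, by simpa using ha, ?_⟩
          have hb' : 0 < x b := lt_of_le_of_ne (hx b) (Ne.symm hb)
          have hab' : 0 < B a b := lt_of_le_of_ne (h0 a b) (Ne.symm hab)
          have : B a b * x b ≤ (B *ᵥ x) a :=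
            Finset.single_le_sum (f := fun j => B a j * x j)
              (fun j _ => mul_nonneg (h0 a j) (hx j)) (mem_univ b)
          have h2 := mul_pos hab' hb'
          simp only [mem_filter, mem_univ, true_and]
          rw [hy]
          linarith [hx a]
        · intro i hi
          simp only [mem_filter, mem_univ, true_and] at hi ⊢
          rw [hy] at hi
          linarith [hx i, hBx i]

/-- A pair of a number and a positive vector which solves the extremal problem of Collatz and
Wielandt for the matrix `B`. -/
structure IsPerronPair (B : Matrix ι ι ℝ) (r : ℝ) (u : ι → ℝ) : Prop where
  pos : 0 < r
  vec_pos : ∀ i, 0 < u i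
  mulVec_eq : B *ᵥ u = r • u
  eq_of_le : ∀ y : ι → ℝ, (∀ i, 0 ≤ y i) → y ≠ 0 → (∀ i, r * y i ≤ (B *ᵥ y) i) →
    B *ᵥ y = r • y ∧ ∀ i, 0 < y i
  le_of_le : ∀ y : ι → ℝ, (∀ i, 0 ≤ y i) → y ≠ 0 → ∀ c, (∀ i, c * y i ≤ (B *ᵥ y) i) → c ≤ r

/-- Compactness yields the largest `r` with `r • u ≤ B u` for some `u` in the simplex. A nonzero
slack `B y - r • y` would become positive under a power of `1 + B`, which commutes with `B`, and `r`
could then be raised. -/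
theorem IrreducibleMatrix.exists_isPerronPair [DecidableEq ι] {B : Matrix ι ι ℝ} (hB : IrreducibleMatrix B)
    (h0 : ∀ i j, 0 ≤ B i j) : ∃ r u, IsPerronPair B r u := by
  have hne : Nonempty ι := by
    by_contra h
    rw [not_nonempty_iff] at h
    exact hB.1 (Subsingleton.elim _ _)
  -- Summing `c * y i ≤ (B y) i` over the coordinates of a point `y` of the simplex gives `c ≤ m`.
  let m : ℝ := ∑ i, ∑ j, B i j
  let S : Set (ℝ × (ι → ℝ)) :=
    (Set.Icc 0 m ×ˢ stdSimplex ℝ ι) ∩ {q | ∀ i, q.1 * q.2 i ≤ (B *ᵥ q.2) i}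
  have hm : 0 ≤ m := Finset.sum_nonneg fun i _ => Finset.sum_nonneg fun j _ => h0 i j
  have hSc : IsCompact S := by
    refine (isCompact_Icc.prod (isCompact_stdSimplex ℝ ι)).inter_right ?_
    rw [Set.ofPred_forall]
    refine isClosed_iInter fun i => isClosed_le ?_ ?_
    · fun_prop
    · change Continuous fun q : ℝ × (ι → ℝ) => ∑ j, B i j * q.2 j
      fun_prop
  have hSne : S.Nonempty := by
    obtain ⟨i⟩ := hne
    refine ⟨(0, Pi.single i 1), ⟨⟨le_rfl, hm⟩, single_mem_stdSimplex ℝ i⟩, fun k => ?_⟩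
    rw [zero_mul]
    exact Matrix.mulVec_nonneg_of_nonneg h0 (single_mem_stdSimplex ℝ i).1 k
  obtain ⟨⟨r, u⟩, ⟨⟨⟨hr0, -⟩, hu⟩, hru⟩, hmax⟩ :=
    hSc.exists_isMaxOn hSne continuous_fst.continuousOn
  simp only at hr0 hu hru
  have hle : ∀ y : ι → ℝ, (∀ i, 0 ≤ y i) → y ≠ 0 → ∀ c, (∀ i, c * y i ≤ (B *ᵥ y) i) → c ≤ r := by
    intro y hy hy0 c hc
    rcases le_total c 0 with h | hc0
    · exact h.trans hr0
    have hs : 0 < ∑ i, y i := by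
      refine lt_of_le_of_ne (Finset.sum_nonneg fun i _ => hy i) fun h => hy0 ?_
      ext i
      exact (Finset.sum_eq_zero_iff_of_nonneg fun i _ => hy i).1 h.symm i (mem_univ i)
    set s := ∑ i, y i with hs'
    have hz : (s⁻¹ • y) ∈ stdSimplex ℝ ι := by
      refine ⟨fun i => mul_nonneg (inv_nonneg.2 hs.le) (hy i), ?_⟩
      simp only [Pi.smul_apply, smul_eq_mul]
      rw [← Finset.mul_sum, ← hs', inv_mul_cancel₀ hs.ne']
    have hcz : ∀ i, c * (s⁻¹ • y) i ≤ (B *ᵥ (s⁻¹ • y)) i := fun i => by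
      rw [mulVec_smul, Pi.smul_apply, Pi.smul_apply, smul_eq_mul, smul_eq_mul]
      have := mul_le_mul_of_nonneg_left (hc i) (inv_nonneg.2 hs.le)
      linarith
    have hcm : c ≤ m := by
      calc c = ∑ i, c * (s⁻¹ • y) i := by rw [← Finset.mul_sum, hz.2, mul_one]
        _ ≤ ∑ i, (B *ᵥ (s⁻¹ • y)) i := Finset.sum_le_sum fun i _ => hcz i
        _ ≤ m := Finset.sum_le_sum fun i _ => Finset.sum_le_sum fun j _ => by
          have h1 : (s⁻¹ • y) j ≤ 1 :=
            hz.2 ▸ Finset.single_le_sum (fun k _ => hz.1 k) (mem_univ j)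
          exact mul_le_of_le_one_right (h0 i j) h1
    exact hmax (a := (c, s⁻¹ • y)) ⟨⟨⟨hc0, hcm⟩, hz⟩, hcz⟩
  have heq : ∀ y : ι → ℝ, (∀ i, 0 ≤ y i) → y ≠ 0 → (∀ i, r * y i ≤ (B *ᵥ y) i) →
      B *ᵥ y = r • y ∧ ∀ i, 0 < y i := by
    intro y hy hy0 hry
    set P := (1 + B) ^ Fintype.card ι with hP
    have hcomm : B * P = P * B :=
      (((Commute.one_right B).add_right (Commute.refl B)).pow_right _).eq
    have hw := hB.one_add_pow_mulVec_pos h0 hy hy0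
    rw [← hP] at hw
    have h1 : B *ᵥ y = r • y := by
      by_contra hne'
      have hz : B *ᵥ y - r • y ≠ 0 := sub_ne_zero.2 hne'
      have hPz := hB.one_add_pow_mulVec_pos h0 (x := B *ᵥ y - r • y)
        (fun i => by simpa using hry i) hz
      rw [← hP] at hPz
      have hPz' : ∀ i, (P *ᵥ (B *ᵥ y - r • y)) i = (B *ᵥ (P *ᵥ y)) i - r * (P *ᵥ y) i := by
        intro i
        rw [mulVec_sub, mulVec_smul, mulVec_mulVec, mulVec_mulVec, hcomm]
        rfl
      obtain ⟨k, -, hk⟩ := Finset.exists_min_image univ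
        (fun i => (P *ᵥ (B *ᵥ y - r • y)) i / (P *ᵥ y) i) univ_nonempty
      have hpos : 0 < (P *ᵥ (B *ᵥ y - r • y)) k / (P *ᵥ y) k := div_pos (hPz k) (hw k)
      have := hle (P *ᵥ y) (fun i => (hw i).le) (fun h => by
          have := hw k
          rw [h] at this
          exact lt_irrefl _ this)
        (r + (P *ᵥ (B *ᵥ y - r • y)) k / (P *ᵥ y) k) (fun i => by
          have h2 := hk i (mem_univ i)
          rw [le_div_iff₀ (hw i), hPz' i] at h2
          linarith)
      linarith
    refine ⟨h1, ?_⟩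
    -- The positive vector `P *ᵥ y` is a multiple of `y`, so `y` has no zero coordinate.
    have hpow : ∀ k : ℕ, (1 + B) ^ k *ᵥ y = (1 + r) ^ k • y := by
      intro k
      induction k with
      | zero => simp
      | succ k ih =>
        rw [pow_succ, ← mulVec_mulVec, add_mulVec, one_mulVec, h1, mulVec_add, mulVec_smul, ih,
          pow_succ, mul_smul, add_smul, one_smul, smul_add, smul_comm]
    intro i
    have := hw i
    rw [hP, hpow, Pi.smul_apply, smul_eq_mul] at this
    exact (pos_iff_pos_of_mul_pos this).1 (by positivity)
  have hu0 : u ≠ 0 := fun h => by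
    have := hu.2
    simp [h] at this
  obtain ⟨hBu, hupos⟩ := heq u hu.1 hu0 hru
  refine ⟨r, u, lt_of_le_of_ne hr0 fun h => hB.1 ?_, hupos, hBu, heq, hle⟩
  ext i j
  have hi := congrFun hBu i
  rw [← h, zero_smul, Pi.zero_apply] at hi
  have := (Finset.sum_eq_zero_iff_of_nonneg
    (fun j _ => mul_nonneg (h0 i j) (hupos j).le)).1 hi j (mem_univ j)
  exact (mul_eq_zero.1 this).resolve_right (hupos j).ne'

namespace IsPerronPair

variable {B : Matrix ι ι ℝ} {r : ℝ} {u : ι → ℝ}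

/-- Subtracting from `x` the largest multiple of `u` that stays below it leaves a nonnegative
eigenvector with a zero coordinate; a nonzero one would be positive. -/
theorem eq_smul (h : IsPerronPair B r u) {x : ι → ℝ} (hx : B *ᵥ x = r • x) : ∃ c : ℝ, x = c • u := by
  cases isEmpty_or_nonempty ι
  · exact ⟨0, Subsingleton.elim _ _⟩
  obtain ⟨k, -, hk⟩ := Finset.exists_min_image univ (fun i => x i / u i) univ_nonempty
  refine ⟨x k / u k, ?_⟩
  by_contra hne
  have hy := h.eq_of_le (x - (x k / u k) • u)
    (fun i => by
      have := hk i (mem_univ i)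
      rw [le_div_iff₀ (h.vec_pos i)] at this
      simpa using this)
    (sub_ne_zero.2 hne)
    (fun i => by
      rw [mulVec_sub, mulVec_smul, hx, h.mulVec_eq, smul_comm, ← smul_sub]
      rfl)
  have := hy.2 k
  simp [(h.vec_pos k).ne'] at this

theorem dotProduct_eq_zero {v x y : ι → ℝ} (hv : Bᵀ *ᵥ v = r • v) (hx : B *ᵥ x - r • x = y) :
    v ⬝ᵥ y = 0 := by
  rw [← hx, dotProduct_sub, dotProduct_mulVec, ← mulVec_transpose, hv, smul_dotProduct,
    dotProduct_smul, sub_self]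

theorem dotProduct_pos {v : ι → ℝ} [Nonempty ι] (hv : ∀ i, 0 < v i) (hu : ∀ i, 0 < u i) :
    0 < v ⬝ᵥ u :=
  Finset.sum_pos (fun i _ => mul_pos (hv i) (hu i)) univ_nonempty

theorem transpose_radius_eq [Nonempty ι] (h : IsPerronPair B r u) {r' : ℝ} {v : ι → ℝ}
    (h' : IsPerronPair Bᵀ r' v) : r' = r := by
  have h1 : v ⬝ᵥ (B *ᵥ u) = (Bᵀ *ᵥ v) ⬝ᵥ u := by rw [dotProduct_mulVec, ← mulVec_transpose]
  rw [h.mulVec_eq, h'.mulVec_eq, dotProduct_smul, smul_dotProduct] at h1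
  exact (mul_right_cancel₀ (dotProduct_pos h'.vec_pos h.vec_pos).ne' h1).symm

/-- The Perron root is algebraically simple. -/
theorem rootMultiplicity_eq_one [DecidableEq ι] [Nonempty ι] (h : IsPerronPair B r u)
    {v : ι → ℝ} (h' : IsPerronPair Bᵀ r v) : B.charpoly.rootMultiplicity r = 1 := by
  rw [← Matrix.charpoly_toLin', ← LinearMap.finrank_maxGenEigenspace_eq]
  set f : End ℝ (ι → ℝ) := Matrix.toLin' B
  have hf : ∀ x, (f - algebraMap ℝ _ r) x = B *ᵥ x - r • x := fun x => by
    simp [f, Module.algebraMap_end_apply]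
  -- There are no longer Jordan chains: if `(B - r) x` equals `c • u`, pairing with the left
  -- eigenvector `v` gives `c * (v ⬝ᵥ u) = 0`, while `v ⬝ᵥ u > 0`.
  have hker : ∀ (k : ℕ) (x : ι → ℝ), ((f - algebraMap ℝ _ r) ^ k) x = 0 → B *ᵥ x = r • x := by
    intro k
    induction k with
    | zero =>
      intro x hx
      have : x = 0 := by simpa using hx
      simp [this]
    | succ k ih =>
      intro x hx
      rw [pow_succ, Module.End.mul_apply] at hx
      have h2 := ih _ hx
      obtain ⟨c, hc⟩ := h.eq_smul h2
      have h3 : v ⬝ᵥ (c • u) = 0 := dotProduct_eq_zero h'.mulVec_eq ((hf x).symm.trans hc)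
      rw [dotProduct_smul, smul_eq_mul] at h3
      have hc0 := (mul_eq_zero.1 h3).resolve_right (dotProduct_pos h'.vec_pos h.vec_pos).ne'
      rw [hf, hc0, zero_smul] at hc
      exact sub_eq_zero.1 hc
  have hspan : f.maxGenEigenspace r = Submodule.span ℝ {u} := by
    ext x
    rw [Module.End.mem_maxGenEigenspace, Submodule.mem_span_singleton]
    constructor
    · rintro ⟨k, hk⟩
      obtain ⟨c, hc⟩ := h.eq_smul (hker k x (by simpa [Algebra.algebraMap_eq_smul_one] using hk))
      exact ⟨c, hc.symm⟩
    · rintro ⟨c, rfl⟩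
      refine ⟨1, ?_⟩
      have := hf (c • u)
      rw [mulVec_smul, h.mulVec_eq, smul_comm, sub_self] at this
      simpa [Algebra.algebraMap_eq_smul_one] using this
  rw [hspan]
  refine finrank_span_singleton fun h0 => ?_
  obtain ⟨i⟩ := ‹Nonempty ι›
  exact (h.vec_pos i).ne' (congrFun h0 i)

end IsPerronPair

theorem Matrix.exists_mulVec_eq_smul_of_mem_aroots [DecidableEq ι] (B : Matrix ι ι ℝ) {z : ℂ}
    (hz : z ∈ B.charpoly.aroots ℂ) :
    ∃ w : ι → ℂ, w ≠ 0 ∧ B.map (algebraMap ℝ ℂ) *ᵥ w = z • w := by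
  have h1 := (Polynomial.mem_aroots.1 hz).2
  have h2 : (B.map (algebraMap ℝ ℂ)).charpoly.IsRoot z := by
    rw [Matrix.charpoly_map, Polynomial.IsRoot, Polynomial.eval_map_algebraMap]
    exact h1
  rw [Polynomial.IsRoot, Matrix.eval_charpoly] at h2
  obtain ⟨w, hw, hw'⟩ := Matrix.exists_mulVec_eq_zero_iff.2 h2
  refine ⟨w, hw, ?_⟩
  rw [sub_mulVec, sub_eq_zero] at hw'
  rw [← hw']
  ext i
  simp [Matrix.mulVec_diagonal]

theorem Complex.eq_norm_mul_of_re_mul_conj_eq {w η : ℂ} (hη : ‖η‖ = 1)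
    (h : (w * (starRingEnd ℂ) η).re = ‖w‖) : w = ‖w‖ * η := by
  have h1 : ‖w * (starRingEnd ℂ) η‖ = ‖w‖ := by simp [hη]
  have h2 : w * (starRingEnd ℂ) η = (‖w‖ : ℂ) := by
    have h3 := Complex.re_eq_norm.1 (h.trans h1.symm)
    apply Complex.ext
    · simpa using h
    · simpa using (Complex.le_def.1 h3).2.symm
  have h4 : (starRingEnd ℂ) η * η = 1 := by
    rw [mul_comm, Complex.mul_conj, Complex.normSq_eq_norm_sq, hη]
    simp
  rw [← h2, mul_assoc, h4, mul_one]

namespace IsPerronPair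

variable {B : Matrix ι ι ℝ} {r : ℝ} {u : ι → ℝ}

theorem norm_mul_le (h0 : ∀ i j, 0 ≤ B i j) {z : ℂ} {w : ι → ℂ}
    (hw : B.map (algebraMap ℝ ℂ) *ᵥ w = z • w) (i : ι) :
    ‖z‖ * ‖w i‖ ≤ (B *ᵥ fun j => ‖w j‖) i := by
  have := congrFun hw i
  rw [← norm_mul, ← smul_eq_mul, ← Pi.smul_apply, ← this]
  refine (norm_sum_le _ _).trans (Finset.sum_le_sum fun j _ => ?_)
  simp [abs_of_nonneg (h0 i j)]

theorem norm_le [DecidableEq ι] (h : IsPerronPair B r u) (h0 : ∀ i j, 0 ≤ B i j) {z : ℂ}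
    (hz : z ∈ B.charpoly.aroots ℂ) : ‖z‖ ≤ r := by
  obtain ⟨w, hw, hzw⟩ := B.exists_mulVec_eq_smul_of_mem_aroots hz
  refine h.le_of_le (fun j => ‖w j‖) (fun j => norm_nonneg _) (fun h' => hw ?_) _
    (norm_mul_le h0 hzw)
  ext j
  simpa using congrFun h' j

/-- Wielandt's lemma: if `z` is a peripheral eigenvalue, then `B` is diagonally similar
to `(z / r) • B`. -/
theorem exists_rotation [DecidableEq ι] (h : IsPerronPair B r u) (h0 : ∀ i j, 0 ≤ B i j) {z : ℂ}
    (hz : z ∈ B.charpoly.aroots ℂ) (hzr : ‖z‖ = r) :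
    ∃ d : ι → ℂ, (∀ i, d i ≠ 0) ∧ ∀ i j, (B i j : ℂ) * d j = z / r * (d i * B i j) := by
  obtain ⟨w, hw, hzw⟩ := B.exists_mulVec_eq_smul_of_mem_aroots hz
  -- For `‖z‖ = r` the moduli of `w` attain the extremum, so they form a positive eigenvector.
  obtain ⟨hBw, hwpos⟩ := h.eq_of_le (fun j => ‖w j‖) (fun j => norm_nonneg _)
    (fun h' => hw (by ext j; simpa using congrFun h' j)) (fun i => hzr ▸ norm_mul_le h0 hzw i)
  have hr0 : (r : ℂ) ≠ 0 := by exact_mod_cast h.pos.ne'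
  have hwne : ∀ i, (‖w i‖ : ℂ) ≠ 0 := fun i => by exact_mod_cast (hwpos i).ne'
  have hw0 : ∀ i, w i ≠ 0 := fun i => norm_pos_iff.1 (hwpos i)
  refine ⟨fun i => w i / ‖w i‖, fun i => div_ne_zero (hw0 i) (hwne i), fun i j => ?_⟩
  -- The phase of `z * w i`. Equality in the triangle inequality for row `i` gives this phase to
  -- every `w j` with `B i j ≠ 0`.
  set η : ℂ := z / r * (w i / ‖w i‖) with hη
  have hη1 : ‖η‖ = 1 := by
    rw [hη, norm_mul, norm_div, norm_div, hzr]
    simp [abs_of_pos h.pos, h.pos.ne', (hw0 i)]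
  have hsum : ∑ j, B i j * (w j * (starRingEnd ℂ) η).re = ∑ j, B i j * ‖w j‖ := by
    have h1 : ∑ j, (B i j : ℂ) * w j = z * w i := congrFun hzw i
    have h2 : ∑ j, B i j * ‖w j‖ = r * ‖w i‖ := congrFun hBw i
    have h3 : z * w i = (r * ‖w i‖ : ℝ) * η := by
      rw [hη]
      push_cast
      field_simp [hwne i]
    have h4 : η * (starRingEnd ℂ) η = 1 := by
      rw [Complex.mul_conj, Complex.normSq_eq_norm_sq, hη1]
      simp
    rw [h2, ← Complex.ofReal_re (r * ‖w i‖), ← mul_one ((r * ‖w i‖ : ℝ) : ℂ), ← h4, ← mul_assoc,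
      ← h3, ← h1, Finset.sum_mul, Complex.re_sum]
    exact Finset.sum_congr rfl fun k _ => by rw [mul_assoc, Complex.re_ofReal_mul]
  have hterm := (Finset.sum_eq_sum_iff_of_le (fun j _ => by
    refine mul_le_mul_of_nonneg_left ?_ (h0 i j)
    calc (w j * (starRingEnd ℂ) η).re ≤ ‖w j * (starRingEnd ℂ) η‖ := Complex.re_le_norm _
      _ = ‖w j‖ := by simp [hη1])).1 hsum j (mem_univ j)
  rcases eq_or_ne (B i j) 0 with hij | hij
  · simp [hij]
  · have h5 := Complex.eq_norm_mul_of_re_mul_conj_eq hη1 (mul_left_cancel₀ hij hterm)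
    have h6 : w j / ‖w j‖ = η := by
      rw [div_eq_iff (hwne j), mul_comm]
      exact h5
    change (B i j : ℂ) * (w j / ‖w j‖) = z / r * (w i / ‖w i‖ * B i j)
    rw [h6, hη]
    ring

/-- Take determinants in `(φ x - B) D = D (φ (x - B))` with the invertible `D = diagonal d`. -/
theorem eval_rotate [DecidableEq ι] {d : ι → ℂ} (hd : ∀ i, d i ≠ 0) {φ : ℂ}
    (hrot : ∀ i j, (B i j : ℂ) * d j = φ * (d i * B i j)) (x : ℂ) :
    (B.map (algebraMap ℝ ℂ)).charpoly.eval (φ * x) =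
      φ ^ Fintype.card ι * (B.map (algebraMap ℝ ℂ)).charpoly.eval x := by
  have hD : (Matrix.diagonal d).det ≠ 0 := by
    rw [Matrix.det_diagonal]
    exact Finset.prod_ne_zero_iff.2 fun i _ => hd i
  have hmat : (Matrix.scalar ι (φ * x) - B.map (algebraMap ℝ ℂ)) * Matrix.diagonal d =
      Matrix.diagonal d * (φ • (Matrix.scalar ι x - B.map (algebraMap ℝ ℂ))) := by
    ext i j
    rw [Matrix.mul_diagonal, Matrix.diagonal_mul]
    have := hrot i j
    rcases eq_or_ne i j with rfl | hij
    · simp [sub_mul, mul_sub] at this ⊢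
      rw [this]
      ring
    · simp [hij] at this ⊢
      rw [this]
      ring
  have hdet := congrArg Matrix.det hmat
  rw [Matrix.det_mul, Matrix.det_mul, Matrix.det_smul, mul_comm] at hdet
  rw [Matrix.eval_charpoly, Matrix.eval_charpoly]
  exact mul_left_cancel₀ hD hdet

-- Substituting `φ X` in `p` multiplies `p` by a unit and turns the factor `X - φ x` into a multiple
-- of `X - x` by a unit.
open Polynomial in
theorem count_rotate_le [DecidableEq ι] {d : ι → ℂ} (hd : ∀ i, d i ≠ 0) {φ : ℂ} (hφ : φ ≠ 0)
    (hrot : ∀ i j, (B i j : ℂ) * d j = φ * (d i * B i j)) (x : ℂ) :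
    (B.charpoly.aroots ℂ).count (φ * x) ≤ (B.charpoly.aroots ℂ).count x := by
  set p := (B.map (algebraMap ℝ ℂ)).charpoly with hp
  have hp0 : p ≠ 0 := (Matrix.charpoly_monic _).ne_zero
  have hcomp : p.comp (C φ * X) = C (φ ^ Fintype.card ι) * p := by
    refine Polynomial.funext fun y => ?_
    rw [Polynomial.eval_comp, eval_mul, eval_mul, eval_C, eval_C, eval_X, hp,
      eval_rotate hd hrot]
  rw [Polynomial.aroots_def, ← Matrix.charpoly_map, ← hp, Polynomial.count_roots,
    Polynomial.count_roots, Polynomial.le_rootMultiplicity_iff hp0]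
  have hdvd := Polynomial.pow_rootMultiplicity_dvd p (φ * x)
  have h2 := map_dvd (Polynomial.compRingHom (C φ * X)) hdvd
  simp only [Polynomial.coe_compRingHom_apply] at h2
  rw [hcomp, Polynomial.pow_comp, Polynomial.sub_comp, Polynomial.X_comp, Polynomial.C_comp, C_mul,
    ← mul_sub, mul_pow] at h2
  exact ((isUnit_C.2 (pow_ne_zero _ hφ).isUnit).dvd_mul_left).1 (dvd_of_mul_left_dvd h2)

end IsPerronPair

/-- The **Perron–Frobenius theorem** for irreducible nonnegative matrices. -/
theorem IrreducibleMatrix.perron_frobenius [DecidableEq ι] {B : Matrix ι ι ℝ} (hB : IrreducibleMatrix B)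
    (h0 : ∀ i j, 0 ≤ B i j) :
    ∃ r u, IsPerronPair B r u ∧ IsPeripherallyCyclic (B.charpoly.aroots ℂ) r ∧
      ((∃ i, 0 < B i i) → ∀ z ∈ B.charpoly.aroots ℂ, ‖z‖ = r → z = r) := by
  obtain ⟨r, u, h⟩ := hB.exists_isPerronPair h0
  obtain ⟨r', v, h'⟩ := hB.transpose.exists_isPerronPair (fun i j => h0 j i)
  have hne : Nonempty ι := by
    by_contra hι
    rw [not_nonempty_iff] at hι
    exact hB.1 (Subsingleton.elim _ _)
  obtain rfl := h.transpose_radius_eq h'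
  have hr0 : (r' : ℂ) ≠ 0 := by exact_mod_cast h.pos.ne'
  have hcount : (B.charpoly.aroots ℂ).count (r' : ℂ) = 1 := by
    rw [Polynomial.aroots_def, Polynomial.count_roots]
    exact (Polynomial.eq_rootMultiplicity_map (algebraMap ℝ ℂ).injective r').symm.trans
      (h.rootMultiplicity_eq_one h')
  refine ⟨r', u, h, IsPeripherallyCyclic.of_mul_mem h.pos (fun z hz => h.norm_le h0 hz) ?_ ?_ ?_,
    ?_⟩
  · intro z hz hzr
    obtain ⟨d, hd, hrot⟩ := h.exists_rotation h0 hz hzr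
    have hz0 : z ≠ 0 := fun h' => by
      rw [h', norm_zero] at hzr
      exact h.pos.ne hzr
    -- The rotation by `z / r'` takes `r'` to `z`, so `z` inherits the simplicity of the Perron
    -- root.
    have := IsPerronPair.count_rotate_le hd (div_ne_zero hz0 hr0) hrot r'
    rw [div_mul_cancel₀ _ hr0, hcount] at this
    exact le_antisymm this (Multiset.one_le_count_iff_mem.2 hz)
  · exact Multiset.one_le_count_iff_mem.1 hcount.ge
  · intro z hz hzr w hw
    obtain ⟨d, hd, hrot⟩ := h.exists_rotation h0 hz hzr
    have := IsPerronPair.eval_rotate hd hrot w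
    rw [Polynomial.aroots_def, ← Matrix.charpoly_map, Polynomial.mem_roots
      (Matrix.charpoly_monic _).ne_zero, Polynomial.IsRoot] at hw ⊢
    rw [hw, mul_zero] at this
    rwa [mul_div_right_comm]
  · rintro ⟨i, hi⟩ z hz hzr
    obtain ⟨d, hd, hrot⟩ := h.exists_rotation h0 hz hzr
    -- A nonzero diagonal entry cancels from the rotation identity and leaves `z / r' = 1`.
    have h1 := hrot i i
    have hi' : (B i i : ℂ) ≠ 0 := by exact_mod_cast hi.ne'
    have h2 : z / r' = 1 := by
      refine mul_right_cancel₀ (mul_ne_zero (hd i) hi') ?_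
      rw [← h1]
      ring
    exact (div_eq_one_iff_eq hr0).1 h2

end PerronFrobenius

/-! ### Reduction of sign-symmetric matrices to nonnegative ones. -/

section SignSymmetric

open Matrix Module Finset

variable {ι : Type*}

open Classical in
/-- The vector of signs of a set of indices: `-1` on the set and `1` outside. -/
noncomputable def signVector (J : Set ι) (i : ι) : ℝ := if i ∈ J then -1 else 1

theorem signVector_mul_self (J : Set ι) (i : ι) : signVector J i * signVector J i = 1 := by
  by_cases h : i ∈ J <;> simp [signVector, h]

theorem signVector_ne_zero (J : Set ι) (i : ι) : signVector J i ≠ 0 := fun h => by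
  simpa [h] using signVector_mul_self J i

theorem JSignSymmetric.signVector_mul_nonneg {B : Matrix ι ι ℝ} {J : Set ι}
    (h : JSignSymmetric B J) (i j : ι) : 0 ≤ signVector J i * B i j * signVector J j := by
  have h1 := h.1 i j
  have h2 := h.2 i j
  by_cases hi : i ∈ J <;> by_cases hj : j ∈ J <;>
    simp only [hi, hj, Xor, signVector, not_true_eq_false, not_false_eq_true, and_true,
      and_false, or_false, or_true, if_true, if_false, true_implies,
      imp_false, not_lt] at h1 h2 ⊢ <;> linarith

/-- The Perron–Frobenius theorem for irreducible `𝒥`-sign-symmetric matrices. -/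
theorem JSignSymmetric.perron_frobenius [Fintype ι] [DecidableEq ι] {B : Matrix ι ι ℝ} {J : Set ι}
    (h : JSignSymmetric B J) (hB : IrreducibleMatrix B) :
    ∃ (r : ℝ) (u : ι → ℝ), (∀ i, 0 < signVector J i * u i) ∧ B *ᵥ u = r • u ∧
      (∀ x : ι → ℝ, B *ᵥ x = r • x → ∃ c : ℝ, x = c • u) ∧
      IsPeripherallyCyclic (B.charpoly.aroots ℂ) r ∧
      ((∃ i, 0 < B i i) → ∀ z ∈ B.charpoly.aroots ℂ, ‖z‖ = r → z = r) := by
  set s := signVector J with hs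
  have hss : ∀ i, s i * s i = 1 := signVector_mul_self J
  let D := Matrix.diagonal s
  have hDD : D * D = 1 := by
    rw [Matrix.diagonal_mul_diagonal, ← Matrix.diagonal_one]
    congr 1
    exact funext hss
  -- Similar to `B` because `D` is an involution, nonnegative, and with the same zero pattern.
  let C := D * B * D
  have hC : ∀ i j, C i j = s i * B i j * s j := fun i j => by
    change (Matrix.diagonal s * B * Matrix.diagonal s) i j = _
    rw [Matrix.mul_diagonal, Matrix.diagonal_mul]
  have hC0 : ∀ i j, C i j ≠ 0 ↔ B i j ≠ 0 := fun i j => by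
    simp [hC, hs, signVector_ne_zero]
  have hCirr : IrreducibleMatrix C := by
    refine ⟨fun h0 => hB.1 ?_, fun S hS hS' => ?_⟩
    · ext i j
      have := hC0 i j
      rw [h0] at this
      simpa using this
    · obtain ⟨i, hi, j, hj, hij⟩ := hB.2 S hS hS'
      exact ⟨i, hi, j, hj, (hC0 i j).2 hij⟩
  have hBC : B = D * C * D := by
    simp only [C, Matrix.mul_assoc, hDD, Matrix.mul_one]
    rw [← Matrix.mul_assoc, hDD, Matrix.one_mul]
  have hchar : C.charpoly = B.charpoly := by
    simp only [C]
    rw [Matrix.charpoly_mul_comm, ← Matrix.mul_assoc, hDD, Matrix.one_mul]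
  obtain ⟨r, u, hru, hper, hdiag⟩ := hCirr.perron_frobenius (fun i j => by
    rw [hC]
    exact h.signVector_mul_nonneg i j)
  rw [hchar] at hper hdiag
  refine ⟨r, D *ᵥ u, fun i => ?_, ?_, fun x hx => ?_, hper, fun ⟨i, hi⟩ => hdiag ⟨i, ?_⟩⟩
  · rw [Matrix.mulVec_diagonal, ← mul_assoc, hss, one_mul]
    exact hru.vec_pos i
  · rw [hBC, mulVec_mulVec, Matrix.mul_assoc, hDD, Matrix.mul_one, ← mulVec_mulVec, hru.mulVec_eq,
      mulVec_smul]
  · obtain ⟨c, hc⟩ := hru.eq_smul (x := D *ᵥ x) (by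
      rw [mulVec_mulVec, Matrix.mul_assoc, hDD, Matrix.mul_one, ← mulVec_mulVec, hx, mulVec_smul])
    refine ⟨c, ?_⟩
    rw [← mulVec_smul, ← hc, mulVec_mulVec, hDD, one_mulVec]
  · rw [hC, mul_right_comm, hss, one_mul]
    exact hi

end SignSymmetric

/-! ### The relation `Ŵ` and the signs of minors. -/

section Orientation

open Matrix

variable {n : ℕ} {J : Set (Fin n)} {J' : Set (IndexPair n)}

/-- Membership of the ordered pairs `i ≺ j` in `Ŵ(𝒥, 𝒥̃)` in terms of signs. -/
theorem mem_WHat_iff_of_lt (p : IndexPair n) :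
    ((p.1.1, p.1.2) ∈ WHat J J' ↔
      signVector J' p = -(signVector J p.1.1 * signVector J p.1.2)) ∧
    ((p.1.2, p.1.1) ∈ WHat J J' ↔
      signVector J' p = signVector J p.1.1 * signVector J p.1.2) := by
  obtain ⟨⟨i, j⟩, hij⟩ := p
  simp only at hij
  simp only [WHat, Set.mem_ofPred_eq, hij.ne, hij.ne', hij, hij.not_gt, exists_true_left,
    IsEmpty.exists_iff, false_or, or_false, signVector, Xor]
  by_cases hi : i ∈ J <;> by_cases hj : j ∈ J <;> by_cases hp : (⟨(i, j), hij⟩ : IndexPair n) ∈ J' <;>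
    norm_num [hi, hj, hp]

/-- If the coordinates of `u ∧ v` have the signs of the set `𝒥̃`, where `u` has the signs of the
set `𝒥`, then the relation `Ŵ(𝒥, 𝒥̃)` is the order of the ratios `v i / u i`. -/
theorem transitiveSet_WHat_of_minors {u v : Fin n → ℝ} (hu : ∀ i, 0 < signVector J i * u i)
    (huv : ∀ p : IndexPair n, 0 < signVector J' p * (u p.1.1 * v p.1.2 - u p.1.2 * v p.1.1)) :
    TransitiveSet (WHat J J') := by
  let x : Fin n → ℝ := fun i => v i / u i
  have hu0 : ∀ i, u i ≠ 0 := fun i h => by simpa [h] using hu i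
  have hsx : ∀ p : IndexPair n,
      -- Dividing the minor by `u i * u j`, whose sign is known, leaves a difference of ratios.
      0 < signVector J' p * (signVector J p.1.1 * signVector J p.1.2) * (x p.1.2 - x p.1.1) := by
    intro p
    have h1 := mul_pos (hu p.1.1) (hu p.1.2)
    have h2 : signVector J' p * (u p.1.1 * v p.1.2 - u p.1.2 * v p.1.1) =
        signVector J' p * (signVector J p.1.1 * signVector J p.1.2) * (x p.1.2 - x p.1.1) *
          ((signVector J p.1.1 * u p.1.1) * (signVector J p.1.2 * u p.1.2)) := by
      have e : u p.1.1 * v p.1.2 - u p.1.2 * v p.1.1 =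
          (x p.1.2 - x p.1.1) * (u p.1.1 * u p.1.2) := by
        simp only [x]
        field_simp [hu0 p.1.1, hu0 p.1.2]
      rw [e]
      linear_combination (-(signVector J' p * ((x p.1.2 - x p.1.1) * (u p.1.1 * u p.1.2)))) *
        (signVector J p.1.1 * signVector J p.1.1 * signVector_mul_self J p.1.2 +
          signVector_mul_self J p.1.1)
    have h3 := huv p
    rw [h2] at h3
    exact (pos_iff_pos_of_mul_pos h3).2 h1
  have hsq : ∀ p : IndexPair n,
      signVector J' p = signVector J p.1.1 * signVector J p.1.2 ∨
      signVector J' p = -(signVector J p.1.1 * signVector J p.1.2) := by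
    intro p
    rw [← sq_eq_sq_iff_eq_or_eq_neg, mul_pow, sq, sq, sq, signVector_mul_self, signVector_mul_self,
      signVector_mul_self, mul_one]
  have hsq1 : ∀ p : IndexPair n, (signVector J p.1.1 * signVector J p.1.2) *
      (signVector J p.1.1 * signVector J p.1.2) = 1 := fun p => by
    linear_combination signVector J p.1.1 * signVector J p.1.1 * signVector_mul_self J p.1.2 +
      signVector_mul_self J p.1.1
  have hne : ∀ p : IndexPair n, signVector J p.1.1 * signVector J p.1.2 ≠ 0 := fun p =>
    mul_ne_zero (signVector_ne_zero _ _) (signVector_ne_zero _ _)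
  have hlt : ∀ p : IndexPair n, ((p.1.1, p.1.2) ∈ WHat J J' ↔ x p.1.2 < x p.1.1) ∧
      ((p.1.2, p.1.1) ∈ WHat J J' ↔ x p.1.1 < x p.1.2) := by
    intro p
    have h1 := hsx p
    rw [(mem_WHat_iff_of_lt p).1, (mem_WHat_iff_of_lt p).2]
    rcases hsq p with h | h
    · rw [h, hsq1, one_mul, sub_pos] at h1
      rw [h, self_eq_neg]
      simp only [hne p, h1, h1.not_gt, iff_self, and_self]
    · rw [h, neg_mul, hsq1, neg_one_mul, neg_sub, sub_pos] at h1
      rw [h, neg_eq_self]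
      simp only [hne p, h1, h1.not_gt, iff_self, and_self]
  have hmem : ∀ i j, (i, j) ∈ WHat J J' ↔ i = j ∨ x j < x i := by
    intro i j
    rcases lt_trichotomy i j with h | rfl | h
    · rw [(hlt ⟨(i, j), h⟩).1]
      simp [h.ne]
    · simp [WHat]
    · rw [(hlt ⟨(j, i), h⟩).2]
      simp [h.ne']
  have htot : ∀ i j, i ≠ j → x i < x j ∨ x j < x i := by
    intro i j hij
    refine lt_or_gt_of_ne fun he => ?_
    rcases lt_or_gt_of_ne hij with h | h
    · simpa [he] using hsx ⟨(i, j), h⟩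
    · simpa [he] using hsx ⟨(j, i), h⟩
  refine ⟨fun i => (hmem i i).2 (Or.inl rfl), fun i j h1 h2 => ?_, fun i j k h1 h2 => ?_,
    fun i j => ?_⟩
  · rw [hmem] at h1 h2
    rcases h1 with h1 | h1
    · exact h1
    · rcases h2 with h2 | h2
      · exact h2.symm
      · exact absurd h1 h2.not_gt
  · rw [hmem] at h1 h2 ⊢
    rcases h1 with rfl | h1
    · exact h2
    · rcases h2 with rfl | h2
      · exact Or.inr h1
      · exact Or.inr (h2.trans h1)
  · rw [hmem, hmem]
    by_cases hij : i = j
    · exact Or.inl (Or.inl hij)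
    · exact (htot i j hij).elim (fun h => Or.inr (Or.inr h)) (fun h => Or.inl (Or.inr h))

theorem TransitiveSet.exists_first {α : Type*} [Finite α] [Nonempty α] {W : Set (α × α)}
    (hW : TransitiveSet W) : ∃ i, ∀ j, (i, j) ∈ W := by
  have := Fintype.ofFinite α
  obtain ⟨hrefl, -, htrans, htot⟩ := hW
  suffices H : ∀ s : Finset α, s.Nonempty → ∃ i, ∀ j ∈ s, (i, j) ∈ W by
    obtain ⟨i, hi⟩ := H Finset.univ Finset.univ_nonempty
    exact ⟨i, fun j => hi j (Finset.mem_univ j)⟩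
  intro s hs
  induction hs using Finset.Nonempty.cons_induction with
  | singleton a => exact ⟨a, by simpa using hrefl a⟩
  | cons a s ha hs ih =>
    obtain ⟨i, hi⟩ := ih
    rcases htot i a with h | h
    · exact ⟨i, fun j hj => by
        rcases Finset.mem_cons.1 hj with rfl | hj
        · exact h
        · exact hi j hj⟩
    · exact ⟨a, fun j hj => by
        rcases Finset.mem_cons.1 hj with rfl | hj
        · exact hrefl _
        · exact htrans _ _ _ h (hi j hj)⟩

/-- If `Ŵ(𝒥, 𝒥̃)` is a linear order, then the diagonal entry at its first element is positive. -/
theorem exists_diag_pos_of_transitiveSet (hn : 2 ≤ n) {A : Matrix (Fin n) (Fin n) ℝ}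
    (hA : JSignSymmetric A J) (hAirr : IrreducibleMatrix A)
    (hA2 : JSignSymmetric (secondCompound A) J') (hW : TransitiveSet (WHat J J')) :
    ∃ i, 0 < A i i := by
  have : Nontrivial (Fin n) := Fin.nontrivial_iff_two_le.2 hn
  obtain ⟨o, ho⟩ := hW.exists_first
  refine ⟨o, ?_⟩
  set s := signVector J
  have hss : ∀ i, s i * s i = 1 := signVector_mul_self J
  have hA' := hA.signVector_mul_nonneg
  have hoo : 0 ≤ A o o := by
    have := hA' o o
    rwa [mul_right_comm, hss, one_mul] at this
  refine lt_of_le_of_ne hoo fun h0 => ?_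
  -- `ε` records whether the pair is listed as `(o, i)` or `(i, o)`; since `o` comes first in `Ŵ`,
  -- both listings fit one sign formula.
  have hpair : ∀ i, i ≠ o → ∃ (p : IndexPair n) (ε : ℝ), signVector J' p = -ε * (s o * s i) ∧
      ((p.1 = (o, i) ∧ ε = 1) ∨ (p.1 = (i, o) ∧ ε = -1)) := by
    intro i hi
    rcases lt_or_gt_of_ne hi with h | h
    · refine ⟨⟨(i, o), h⟩, -1, ?_, Or.inr ⟨rfl, rfl⟩⟩
      rw [(mem_WHat_iff_of_lt (J := J) (J' := J') ⟨(i, o), h⟩).2.1 (ho i)]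
      ring
    · refine ⟨⟨(o, i), h⟩, 1, ?_, Or.inl ⟨rfl, rfl⟩⟩
      rw [(mem_WHat_iff_of_lt (J := J) (J' := J') ⟨(o, i), h⟩).1.1 (ho i)]
      ring
  -- As `A o o = 0`, the minor is `-ε * δ * (A o j * A i o)`, and the signs of the two pairs
  -- contribute `ε * δ * s i * s j`.
  have hminor : ∀ i j, i ≠ o → j ≠ o → 0 ≤ -(s i * s j * (A o j * A i o)) := by
    intro i j hi hj
    obtain ⟨p, ε, hp, hpε⟩ := hpair i hi
    obtain ⟨q, δ, hq, hqδ⟩ := hpair j hj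
    have := hA2.signVector_mul_nonneg p q
    rw [hp, hq, secondCompound_apply] at this
    have hso := hss o
    rcases hpε with ⟨hp1, rfl⟩ | ⟨hp1, rfl⟩ <;> rcases hqδ with ⟨hq1, rfl⟩ | ⟨hq1, rfl⟩ <;>
      rw [hp1, hq1] at this <;> simp only [← h0] at this <;>
      refine this.trans_eq ?_ <;>
      linear_combination (-(s i * s j * A o j * A i o)) * hso
  -- Irreducibility supplies nonzero entries `A o j` and `A i o`; with signs both are positive,
  -- against `hminor`.
  obtain ⟨a, ha, j, hj, haj⟩ := hAirr.2 {o} (Set.singleton_nonempty o) (Set.singleton_ne_univ o)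
  obtain ⟨i, hi, b, hb, hib⟩ := hAirr.2 {o}ᶜ (by simp [Set.nonempty_compl]) (by simp)
  obtain rfl : a = o := ha
  obtain rfl : b = a := by simpa using hb
  have h1 : 0 < s b * A b j * s j := lt_of_le_of_ne (hA' b j)
    (mul_ne_zero (mul_ne_zero (signVector_ne_zero _ _) haj) (signVector_ne_zero _ _)).symm
  have h2 : 0 < s i * A i b * s b := lt_of_le_of_ne (hA' i b)
    (mul_ne_zero (mul_ne_zero (signVector_ne_zero _ _) hib) (signVector_ne_zero _ _)).symm
  have h3 := hminor i j hi hj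
  have h4 : s b * A b j * s j * (s i * A i b * s b) = s i * s j * (A b j * A i b) := by
    linear_combination (s i * s j * (A b j * A i b)) * hss b
  linarith [mul_pos h1 h2]

end Orientation

/-! ### Comparing the peripheral spectra of `A` and `A ∧ A`. -/

section Spectra

open Matrix Module Finset

theorem rho_eq_of_isPeripherallyCyclic {V : Type*} [AddCommGroup V] [Module ℝ V]
    [Module.Finite ℝ V] [Module.Free ℝ V] {f : V →ₗ[ℝ] V} {r : ℝ}
    (h : IsPeripherallyCyclic (eigenvaluesOf f) r) : rho f = r := by
  refine IsGreatest.csSup_eq ⟨⟨r, ((h.mem_iff r).2 rfl).1, by simp [abs_of_pos h.pos]⟩, ?_⟩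
  rintro _ ⟨z, hz, rfl⟩
  exact h.norm_le z hz

namespace IsPeripherallyCyclic

theorem mem {M : Multiset ℂ} {r : ℝ} (h : IsPeripherallyCyclic M r) : (r : ℂ) ∈ M :=
  ((h.mem_iff r).2 rfl).1

theorem card_filter_pos {M : Multiset ℂ} {r : ℝ} (h : IsPeripherallyCyclic M r) :
    0 < (M.filter fun w => ‖w‖ = r).card :=
  Multiset.card_pos_iff_exists_mem.2 ⟨r, Multiset.mem_filter.2 ((h.mem_iff r).2 rfl)⟩

variable {n : ℕ} {r s : ℝ}

/-- Simplicity in terms of indices; for the family of products it rules out coincidences of maximal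
modulus. -/
theorem eq_of_apply_eq {ι : Type*} [Fintype ι] {f : ι → ℂ}
    (h : IsPeripherallyCyclic (univ.val.map f) r) {a b : ι} (ha : ‖f a‖ = r) (hab : f a = f b) :
    a = b := by
  have h1 := h.count_eq_one (f a) (Multiset.mem_map_of_mem f (mem_univ a)) ha
  rw [Multiset.count_map] at h1
  have h2 : (univ.filter fun i => f a = f i).card = 1 := h1
  exact Finset.card_le_one.1 h2.le a (by simp) b (by simp [hab])

variable {ev : Fin n → ℂ}

theorem mul_mem_map_mul (i j : Fin n) (hij : i ≠ j) :
    ev i * ev j ∈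
      (univ : Finset (IndexPair n)).val.map (fun p => ev p.1.1 * ev p.1.2) := by
  rcases lt_or_gt_of_ne hij with h | h
  · exact Multiset.mem_map.2 ⟨⟨(i, j), h⟩, mem_univ _, rfl⟩
  · exact Multiset.mem_map.2 ⟨⟨(j, i), h⟩, mem_univ _, mul_comm _ _⟩

theorem pair_eq
    (h2 : IsPeripherallyCyclic
      ((univ : Finset (IndexPair n)).val.map (fun p => ev p.1.1 * ev p.1.2)) s)
    {i j k l : Fin n} (hij : i ≠ j) (hkl : k ≠ l) (hs : ‖ev i * ev j‖ = s)
    (h : ev i * ev j = ev k * ev l) : (i = k ∧ j = l) ∨ (i = l ∧ j = k) := by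
  have key : ∀ {i j k l : Fin n} (hij : i < j) (hkl : k < l), ‖ev i * ev j‖ = s →
      ev i * ev j = ev k * ev l → i = k ∧ j = l := by
    intro i j k l hij hkl hs h
    have := h2.eq_of_apply_eq (a := ⟨(i, j), hij⟩) (b := ⟨(k, l), hkl⟩) hs h
    simpa using this
  rcases lt_or_gt_of_ne hij with h1 | h1 <;> rcases lt_or_gt_of_ne hkl with h3 | h3
  · exact Or.inl (key h1 h3 hs h)
  · exact Or.inr (key h1 h3 hs (by rw [h, mul_comm]))
  · exact Or.inr (key h1 h3 (by rwa [mul_comm]) (by rw [mul_comm, h])).symm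
  · exact Or.inl (key h1 h3 (by rwa [mul_comm]) (by rw [mul_comm, h, mul_comm])).symm

/-- If the spectrum of `A` and the spectrum of `A ∧ A` are both peripherally cyclic, then `A` is
either primitive or has the index of imprimitivity three, as `A ∧ A` then has. -/
theorem card_filter_eq_one_or_three (h : IsPeripherallyCyclic (univ.val.map ev) r)
    (h2 : IsPeripherallyCyclic
      ((univ : Finset (IndexPair n)).val.map (fun p => ev p.1.1 * ev p.1.2)) s) :
    ((univ.val.map ev).filter fun w => ‖w‖ = r).card = 1 ∨
    (((univ.val.map ev).filter fun w => ‖w‖ = r).card = 3 ∧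
      (((univ : Finset (IndexPair n)).val.map (fun p => ev p.1.1 * ev p.1.2)).filter
        fun w => ‖w‖ = s).card = 3) := by
  have hpos := h.card_filter_pos
  have hkpos := h2.card_filter_pos
  have hmem := h.mem_iff
  have hmem2 := h2.mem_iff
  set m := ((univ.val.map ev).filter fun w => ‖w‖ = r).card
  set k := (((univ : Finset (IndexPair n)).val.map (fun p => ev p.1.1 * ev p.1.2)).filter
    fun w => ‖w‖ = s).card
  by_cases hm1 : m = 1
  · exact Or.inl hm1
  right
  have hr := h.pos
  have hr0 : (r : ℂ) ≠ 0 := by exact_mod_cast hr.ne'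
  have hle : ∀ i, ‖ev i‖ ≤ r := fun i => h.norm_le _ (Multiset.mem_map_of_mem ev (mem_univ i))
  have hω := Complex.isPrimitiveRoot_exp m hpos.ne'
  set ω := Complex.exp (2 * Real.pi * Complex.I / m)
  have hroot : ∀ a : ℕ, ∃ i, ev i = r * ω ^ a ∧ ‖ev i‖ = r := by
    intro a
    have := (hmem (r * ω ^ a)).2 (by
      rw [mul_pow, ← pow_mul, mul_comm a, pow_mul, hω.pow_eq_one, one_pow, mul_one])
    obtain ⟨i, -, hi⟩ := Multiset.mem_map.1 this.1
    exact ⟨i, hi, hi ▸ this.2⟩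
  obtain ⟨i0, he0, hn0⟩ := hroot 0
  obtain ⟨i1, he1, hn1⟩ := hroot 1
  obtain ⟨i2, he2, hn2⟩ := hroot 2
  obtain ⟨i3, he3, hn3⟩ := hroot 3
  have hdist : ∀ {i j : Fin n} {a b : ℕ}, ev i = r * ω ^ a → ev j = r * ω ^ b → a < m → b < m →
      a ≠ b → i ≠ j := by
    intro i j a b hi hj ha hb hab hij
    rw [hij, hj] at hi
    exact hab (hω.pow_inj ha hb (mul_left_cancel₀ hr0 hi).symm)
  have h01 : i0 ≠ i1 := hdist he0 he1 (by omega) (by omega) (by omega)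
  have hs : s = r ^ 2 := by
    apply le_antisymm
    · obtain ⟨p, -, hp⟩ := Multiset.mem_map.1 h2.mem
      have h3 : ‖ev p.1.1 * ev p.1.2‖ = s := by rw [hp]; simp [h2.pos.le]
      rw [← h3, norm_mul, sq]
      exact mul_le_mul (hle _) (hle _) (norm_nonneg _) hr.le
    · have h3 := h2.norm_le _ (mul_mem_map_mul (ev := ev) i0 i1 h01)
      rwa [norm_mul, hn0, hn1, ← sq] at h3
  have hnorm : ∀ i j, ‖ev i * ev j‖ = s → ‖ev i‖ = r ∧ ‖ev j‖ = r := by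
    intro i j hij
    rw [norm_mul, hs] at hij
    constructor <;> nlinarith [hle i, hle j, norm_nonneg (ev i), norm_nonneg (ev j)]
  have hpow : ∀ i, ‖ev i‖ = r → ev i ^ m = (r : ℂ) ^ m := fun i hi =>
    (hmem _).1 ⟨Multiset.mem_map_of_mem ev (mem_univ i), hi⟩
  -- If `m = 2`, peripheral eigenvalues square to `r ^ 2`. As `s = r ^ 2` is a product of two of
  -- them, these coincide despite their distinct indices.
  have hm2 : m ≠ 2 := by
    intro hm
    obtain ⟨p, -, hp⟩ := Multiset.mem_map.1 h2.mem
    have hp' := hnorm p.1.1 p.1.2 (by rw [hp]; simp [h2.pos.le])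
    have e1 := hpow _ hp'.1
    rw [hs] at hp
    rw [hm] at e1
    have e2 : ev p.1.1 * ev p.1.1 = ev p.1.1 * ev p.1.2 := by
      rw [hp, ← sq, e1]
      push_cast
      rfl
    have hne : ev p.1.1 ≠ 0 := fun h0 => by
      rw [h0, norm_zero] at hp'
      exact hr.ne hp'.1
    exact p.2.ne (h.eq_of_apply_eq hp'.1 (mul_left_cancel₀ hne e2))
  -- The products `1 · ω³` and `ω · ω²` would be one peripheral eigenvalue counted twice.
  have hm4 : m < 4 := by
    by_contra hm
    have h03 : i0 ≠ i3 := hdist he0 he3 (by omega) (by omega) (by omega)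
    have h12 : i1 ≠ i2 := hdist he1 he2 (by omega) (by omega) (by omega)
    have h02 : i0 ≠ i2 := hdist he0 he2 (by omega) (by omega) (by omega)
    rcases h2.pair_eq h03 h12 (by rw [norm_mul, hn0, hn3, hs, sq])
      (by rw [he0, he1, he2, he3]; ring) with h5 | h5
    · exact h01 h5.1
    · exact h02 h5.1
  have hm3 : m = 3 := by omega
  -- `k` divides 3 because every peripheral product is `s` times a cube root of unity; 3 divides `k`
  -- because `s * ω` is such a product.
  refine ⟨hm3, Nat.dvd_antisymm ?_ ?_⟩
  · have hη := Complex.isPrimitiveRoot_exp k hkpos.ne'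
    set η := Complex.exp (2 * Real.pi * Complex.I / k)
    have h3 := (hmem2 (s * η)).2 (by rw [mul_pow, hη.pow_eq_one, mul_one])
    obtain ⟨p, -, hp⟩ := Multiset.mem_map.1 h3.1
    have hp' := hnorm p.1.1 p.1.2 (by rw [hp]; exact h3.2)
    have e1 := congrArg (· ^ 3) hp
    have e2 := hpow _ hp'.1
    have e3 := hpow _ hp'.2
    rw [hm3] at e2 e3
    simp only [mul_pow, e2, e3] at e1
    refine hη.dvd_of_pow_eq_one 3 (mul_left_cancel₀ (pow_ne_zero 6 hr0) ?_)
    rw [hs] at e1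
    push_cast at e1
    linear_combination -e1
  · have h3 : ‖ev i0 * ev i1‖ = s := by rw [norm_mul, hn0, hn1, hs, sq]
    have h4 := (hmem2 _).1 ⟨mul_mem_map_mul i0 i1 h01, h3⟩
    rw [← hm3]
    refine hω.dvd_of_pow_eq_one k (mul_left_cancel₀ (pow_ne_zero k (pow_ne_zero 2 hr0)) ?_)
    rw [he0, he1, hs] at h4
    push_cast at h4
    rw [mul_one, ← mul_pow, ← h4]
    ring

end IsPeripherallyCyclic

/-- A finite family of complex numbers can be numbered in the order of decreasing moduli, and the
numbers of equal moduli in the order of decreasing real parts. -/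
theorem exists_perm_antitone_norm {n : ℕ} (t : Fin n → ℂ) :
    ∃ σ : Equiv.Perm (Fin n), ∀ i j, i ≤ j →
      ‖t (σ j)‖ < ‖t (σ i)‖ ∨ (‖t (σ j)‖ = ‖t (σ i)‖ ∧ (t (σ j)).re ≤ (t (σ i)).re) := by
  let f : Fin n → ℝ ×ₗ ℝ := fun i => toLex (-‖t i‖, -(t i).re)
  refine ⟨Tuple.sort f, fun i j hij => ?_⟩
  have := Tuple.monotone_sort f hij
  simp only [Function.comp_apply, f, Prod.Lex.toLex_le_toLex, neg_lt_neg_iff, neg_inj,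
    neg_le_neg_iff] at this
  rcases this with h | ⟨h, h'⟩
  · exact Or.inl h
  · exact Or.inr ⟨h.symm, h'⟩

/-- The two leading eigenvalues of a primitive matrix and the peripheral spectrum of its exterior
square. -/
theorem IsPeripherallyCyclic.second_eigenvalue {n : ℕ} {r s : ℝ} {ev : Fin n → ℂ} (hn : 2 ≤ n)
    (hsort : ∀ i j, i ≤ j → ‖ev j‖ < ‖ev i‖ ∨ (‖ev j‖ = ‖ev i‖ ∧ (ev j).re ≤ (ev i).re))
    (h : IsPeripherallyCyclic (univ.val.map ev) r)
    (h2 : IsPeripherallyCyclic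
      ((univ : Finset (IndexPair n)).val.map (fun p => ev p.1.1 * ev p.1.2)) s)
    (hprim : ((univ.val.map ev).filter fun w => ‖w‖ = r).card = 1) :
    ∃ l : ℝ, s = r * l ∧ ev ⟨0, by omega⟩ = r ∧ ev ⟨1, by omega⟩ = l ∧ 0 < l ∧ l < r ∧
      (∀ i, ‖ev i‖ = l → (univ.val.map ev).count (ev i) = 1) ∧
      (((univ : Finset (IndexPair n)).val.map (fun p => ev p.1.1 * ev p.1.2)).filter
        fun w => ‖w‖ = s).card + 1 ≤ n ∧
      (∀ i : Fin n, ‖ev i‖ = l ↔ 1 ≤ i.val ∧ i.val ≤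
        (((univ : Finset (IndexPair n)).val.map (fun p => ev p.1.1 * ev p.1.2)).filter
          fun w => ‖w‖ = s).card) ∧
      (∀ z : ℂ, (∃ i, ‖ev i‖ = l ∧ ev i = z) ↔
        z ^ (((univ : Finset (IndexPair n)).val.map (fun p => ev p.1.1 * ev p.1.2)).filter
          fun w => ‖w‖ = s).card = (l : ℂ) ^
        (((univ : Finset (IndexPair n)).val.map (fun p => ev p.1.1 * ev p.1.2)).filter
          fun w => ‖w‖ = s).card) := by
  set o : Fin n := ⟨0, by omega⟩ with ho
  set e : Fin n := ⟨1, by omega⟩ with he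
  have hr := h.pos
  have hr0 : (r : ℂ) ≠ 0 := by exact_mod_cast hr.ne'
  have hoe : o ≠ e := by simp [ho, he]
  have hanti : ∀ i j, i ≤ j → ‖ev j‖ ≤ ‖ev i‖ := fun i j hij =>
    (hsort i j hij).elim le_of_lt fun h => h.1.le
  have hole : ∀ i, o ≤ i := fun i => Fin.mk_le_of_le_val (Nat.zero_le _)
  have hele : ∀ i, i ≠ o → e ≤ i := fun i hi => Fin.mk_le_of_le_val (by
    rcases Nat.eq_zero_or_pos i.val with h | h
    · exact absurd (Fin.ext h) hi
    · exact h)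
  have hle : ∀ i, ‖ev i‖ ≤ r := fun i => h.norm_le _ (Multiset.mem_map_of_mem ev (mem_univ i))
  have hr1 : ∀ i, ‖ev i‖ = r → ev i = r := fun i hi => by
    have := (h.mem_iff (ev i)).1 ⟨Multiset.mem_map_of_mem ev (mem_univ i), hi⟩
    rwa [hprim, pow_one, pow_one] at this
  have hevo : ev o = r := by
    obtain ⟨i, -, hi⟩ := Multiset.mem_map.1 h.mem
    refine hr1 o (le_antisymm (hle o) ?_)
    have := hanti o i (hole i)
    rw [hi] at this
    simpa [abs_of_pos hr] using this
  have hevo' : ‖ev o‖ = r := by rw [hevo]; simp [hr.le]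
  have hlt : ∀ i, i ≠ o → ‖ev i‖ < r := fun i hi => lt_of_le_of_ne (hle i) fun h' =>
    hi (h.eq_of_apply_eq h' ((hr1 i h').trans hevo.symm))
  set l := ‖ev e‖ with hl
  have hile : ∀ i, i ≠ o → ‖ev i‖ ≤ l := fun i hi => hanti e i (hele i hi)
  have hpne : ∀ p : IndexPair n, p.1.2 ≠ o := fun p hp => by
    have := p.2
    rw [hp] at this
    exact absurd (hole p.1.1) this.not_ge
  have hsle : r * l ≤ s := by
    have := h2.norm_le _ (mul_mem_map_mul (ev := ev) o e hoe)
    rwa [norm_mul, hevo'] at this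
  -- A product that avoids the leading index has modulus below `r * l ≤ s`.
  have hpair : ∀ p : IndexPair n, ‖ev p.1.1 * ev p.1.2‖ = s → p.1.1 = o ∧ r * ‖ev p.1.2‖ = s := by
    intro p hp
    have hl2 := hile _ (hpne p)
    have hp1 : p.1.1 = o := by
      by_contra hne
      have h3 := hlt _ hne
      rw [norm_mul] at hp
      have hspos := h2.pos
      have h4 : 0 < ‖ev p.1.2‖ := by
        rcases (norm_nonneg (ev p.1.2)).lt_or_eq with h' | h'
        · exact h'
        · rw [← h', mul_zero] at hp
          exact absurd hp hspos.ne
      nlinarith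
    refine ⟨hp1, ?_⟩
    rw [← hp, norm_mul, hp1, hevo']
  obtain ⟨q, -, hq⟩ := Multiset.mem_map.1 h2.mem
  obtain ⟨hq1, hq2⟩ := hpair q (by rw [hq]; simp [h2.pos.le])
  have hs : s = r * l := le_antisymm
    (by rw [← hq2]; exact mul_le_mul_of_nonneg_left (hile _ (hpne q)) hr.le) hsle
  have hlpos : 0 < l := by
    have := h2.pos
    rw [hs] at this
    exact (pos_iff_pos_of_mul_pos this).1 hr
  have hqe : ev q.1.2 = l := by
    rw [hq1, hevo, hs] at hq
    push_cast at hq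
    exact mul_left_cancel₀ hr0 hq
  -- The eigenvalue `s` of `A ∧ A` shows that `l` itself occurs on its circle; the tie-break by real
  -- parts puts it at index 1.
  have heve : ev e = l := by
    have h3 : (ev q.1.2).re ≤ (ev e).re := by
      rcases hsort e q.1.2 (hele _ (hpne q)) with h' | h'
      · rw [hqe] at h'
        simp [abs_of_pos hlpos, ← hl] at h'
      · exact h'.2
    have h4 : (ev e).re = ‖ev e‖ := le_antisymm (Complex.re_le_norm _) (by
      rw [hqe, Complex.ofReal_re] at h3
      exact h3)
    have h5 := Complex.re_eq_norm.1 h4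
    apply Complex.ext
    · rw [h4, Complex.ofReal_re]
    · simpa using (Complex.le_def.1 h5).2.symm
  have hno : ∀ i, ‖ev i‖ = l → i ≠ o := fun i hi hio => by
    rw [hio, hevo'] at hi
    exact (hlt e hoe.symm).ne' hi
  have hns : ∀ i, ‖ev i‖ = l → ‖ev o * ev i‖ = s := fun i hi => by
    rw [norm_mul, hevo', hi, hs]
  have hinj : ∀ i j, ‖ev i‖ = l → ev i = ev j → i = j := by
    intro i j hi hij
    have hj : ‖ev j‖ = l := hij ▸ hi
    rcases h2.pair_eq (hno i hi).symm (hno j hj).symm (hns i hi) (by rw [hij]) with h' | h'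
    · exact h'.2
    · exact absurd h'.2 (hno i hi)
  refine ⟨l, hs, hevo, heve, hlpos, hlt e hoe.symm, ?_, and_assoc.1 ⟨?_, ?_⟩⟩
  · intro i hi
    rw [Multiset.count_map]
    change (univ.filter fun j => ev i = ev j).card = 1
    rw [Finset.card_eq_one]
    refine ⟨i, ?_⟩
    ext j
    simp only [mem_filter, mem_univ, true_and, mem_singleton]
    exact ⟨fun hij => (hinj i j hi hij).symm, fun hij => by rw [hij]⟩
  · have hcard : (((univ : Finset (IndexPair n)).val.map (fun p => ev p.1.1 * ev p.1.2)).filter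
        fun w => ‖w‖ = s).card = (univ.filter fun i => ‖ev i‖ = l).card := by
      rw [Multiset.filter_map, Multiset.card_map]
      change (univ.filter fun p : IndexPair n => ‖ev p.1.1 * ev p.1.2‖ = s).card = _
      symm
      refine Finset.card_bij
        (fun i hi => ⟨(o, i), lt_of_le_of_ne (hole i) (hno i (mem_filter.1 hi).2).symm⟩) ?_ ?_ ?_
      · intro i hi
        simpa using hns i (mem_filter.1 hi).2
      · intro i _ j _ hij
        simpa using hij
      · intro p hp
        obtain ⟨hp1, hp2⟩ := hpair p (mem_filter.1 hp).2
        refine ⟨p.1.2, ?_, ?_⟩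
        · rw [hs] at hp2
          simpa using mul_left_cancel₀ hr.ne' hp2
        · exact Subtype.ext (Prod.ext hp1.symm rfl)
    rw [hcard]
    set S := univ.filter fun i => ‖ev i‖ = l with hS
    have heS : e ∈ S := by simp [hS, hl]
    -- Moduli decrease, so `S` is an interval starting at index 1, and its size equals its last
    -- index.
    obtain ⟨m, hmS, hm⟩ := S.exists_max_image id ⟨e, heS⟩
    have hSm : S = Finset.Icc e m := by
      ext i
      rw [Finset.mem_Icc]
      constructor
      · intro hi
        exact ⟨hele i (hno i (mem_filter.1 hi).2), hm i hi⟩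
      · rintro ⟨h1, h3⟩
        refine mem_filter.2 ⟨mem_univ _, le_antisymm (hanti e i h1) ?_⟩
        rw [← (mem_filter.1 hmS).2]
        exact hanti i m h3
    have hScard : S.card = m.val := by
      rw [hSm, Fin.card_Icc]
      simp [he]
    rw [hScard]
    refine ⟨m.isLt, fun i => ?_⟩
    have : ‖ev i‖ = l ↔ i ∈ S := by simp [hS]
    rw [this, hSm, Finset.mem_Icc]
    exact Iff.rfl
  · intro z
    have hmem2 := h2.mem_iff (r * z)
    set k := (((univ : Finset (IndexPair n)).val.map (fun p => ev p.1.1 * ev p.1.2)).filter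
      fun w => ‖w‖ = s).card
    rw [mul_pow, hs] at hmem2
    push_cast at hmem2
    rw [mul_pow] at hmem2
    constructor
    · rintro ⟨i, hi, rfl⟩
      refine mul_left_cancel₀ (pow_ne_zero k hr0) (hmem2.1 ⟨?_, ?_⟩)
      · rw [← hevo]
        exact mul_mem_map_mul o i (hno i hi).symm
      · rw [← hevo, hns i hi, hs]
    · intro hz
      obtain ⟨h3, h4⟩ := hmem2.2 (by rw [hz])
      obtain ⟨p, -, hp⟩ := Multiset.mem_map.1 h3
      obtain ⟨hp1, hp2⟩ := hpair p (by rw [hp, h4, hs])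
      rw [hs] at hp2
      refine ⟨p.1.2, mul_left_cancel₀ hr.ne' hp2, ?_⟩
      rw [hp1, hevo] at hp
      exact mul_left_cancel₀ hr0 hp

end Spectra

/-! ### From a real second eigenvector to the order `Ŵ`. -/

section RealEigenvectors

open Matrix

theorem Matrix.exists_real_eigenvector {ι : Type*} [Fintype ι] [DecidableEq ι] (A : Matrix ι ι ℝ)
    {l : ℝ} (hl : (l : ℂ) ∈ A.charpoly.aroots ℂ) : ∃ v : ι → ℝ, v ≠ 0 ∧ A *ᵥ v = l • v := by
  have h1 := (Polynomial.mem_aroots.1 hl).2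
  have h2 : A.charpoly.eval l = 0 := by
    have h3 : Polynomial.aeval ((algebraMap ℝ ℂ) l) A.charpoly = 0 := h1
    rw [Polynomial.aeval_algebraMap_apply] at h3
    simpa using h3
  rw [Matrix.eval_charpoly] at h2
  obtain ⟨v, hv, hv'⟩ := Matrix.exists_mulVec_eq_zero_iff.2 h2
  refine ⟨v, hv, ?_⟩
  rw [sub_mulVec, sub_eq_zero] at hv'
  rw [← hv']
  ext i
  simp [Matrix.mulVec_diagonal]

/-- A bivector of two vectors vanishes only if they are proportional. -/
theorem exists_eq_smul_of_minors_eq_zero {n : ℕ} {u v : Fin n → ℝ} {o : Fin n} (ho : u o ≠ 0)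
    (h : ∀ p : IndexPair n, u p.1.1 * v p.1.2 - u p.1.2 * v p.1.1 = 0) :
    v = (v o / u o) • u := by
  ext i
  rw [Pi.smul_apply, smul_eq_mul, div_mul_eq_mul_div, eq_div_iff ho]
  rcases lt_trichotomy i o with hi | rfl | hi
  · linear_combination -h ⟨(i, o), hi⟩
  · rfl
  · linear_combination h ⟨(o, i), hi⟩

/-- If the leading eigenvalues of `A` and `A ∧ A` are `r` and `r * l` with a second eigenvalue
`l ≠ r` of `A`, then the relation `Ŵ(𝒥, 𝒥̃)` is a linear order. -/
theorem transitiveSet_WHat_of_eigenvalue {n : ℕ} (hn : 0 < n) {A : Matrix (Fin n) (Fin n) ℝ}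
    {J : Set (Fin n)} {J' : Set (IndexPair n)} {r l : ℝ} {u : Fin n → ℝ} {y : IndexPair n → ℝ}
    (hu : ∀ i, 0 < signVector J i * u i) (hAu : A *ᵥ u = r • u)
    (hy : ∀ p, 0 < signVector J' p * y p)
    (hyl : ∀ x : IndexPair n → ℝ, secondCompound A *ᵥ x = (r * l) • x → ∃ c : ℝ, x = c • y)
    (hl : (l : ℂ) ∈ A.charpoly.aroots ℂ) (hlr : l ≠ r) : TransitiveSet (WHat J J') := by
  obtain ⟨v, hv, hAv⟩ := A.exists_real_eigenvector hl
  obtain ⟨c, hc⟩ := hyl (fun p => u p.1.1 * v p.1.2 - u p.1.2 * v p.1.1) (by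
    rw [secondCompound_eq_compoundTwo, compoundTwo_mulVec, hAu, hAv]
    ext p
    simp only [Pi.smul_apply, smul_eq_mul]
    ring)
  have hc' : ∀ p : IndexPair n, u p.1.1 * v p.1.2 - u p.1.2 * v p.1.1 = c * y p := congrFun hc
  let o : Fin n := ⟨0, hn⟩
  have ho : u o ≠ 0 := fun h => by simpa [h] using hu o
  -- If `u ∧ v = 0`, then `v` is a multiple of `u`, although their eigenvalues differ.
  have hc0 : c ≠ 0 := by
    rintro rfl
    have h1 := exists_eq_smul_of_minors_eq_zero ho (fun p => by rw [hc' p, zero_mul])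
    have h2 : l • v = r • v := by
      rw [← hAv, h1, mulVec_smul, hAu, smul_comm]
    rw [← sub_eq_zero, ← sub_smul] at h2
    exact (smul_ne_zero (sub_ne_zero.2 hlr) hv) h2
  rcases lt_or_gt_of_ne hc0 with h | h
  · refine transitiveSet_WHat_of_minors (v := -v) hu fun p => ?_
    have e : signVector J' p * (u p.1.1 * (-v) p.1.2 - u p.1.2 * (-v) p.1.1) =
        -c * (signVector J' p * y p) := by
      simp only [Pi.neg_apply]
      linear_combination (-signVector J' p) * hc' p
    rw [e]
    exact mul_pos (neg_pos.2 h) (hy p)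
  · refine transitiveSet_WHat_of_minors (v := v) hu fun p => ?_
    rw [hc' p, mul_left_comm]
    exact mul_pos h (hy p)

end RealEigenvectors

/-! ### Numbering of the eigenvalues and the main theorem. -/

/-- The eigenvalues of `A` and `A ∧ A` in the order of decreasing moduli. -/
theorem exists_sorted_eigenvalues {n : ℕ} (A : Matrix (Fin n) (Fin n) ℝ) :
    ∃ ev : Fin n → ℂ, A.charpoly.aroots ℂ = Finset.univ.val.map ev ∧
      (secondCompound A).charpoly.aroots ℂ =
        (Finset.univ : Finset (IndexPair n)).val.map (fun p => ev p.1.1 * ev p.1.2) ∧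
      ∀ i j, i ≤ j → ‖ev j‖ < ‖ev i‖ ∨ (‖ev j‖ = ‖ev i‖ ∧ (ev j).re ≤ (ev i).re) := by
  obtain ⟨t, ht, ht2⟩ := (A.map (algebraMap ℝ ℂ)).exists_charpoly_roots_compoundTwo
  obtain ⟨σ, hσ⟩ := exists_perm_antitone_norm t
  have hperm : Finset.univ.val.map t = Finset.univ.val.map (t ∘ σ) := by
    rw [← Multiset.map_map]
    congr 1
    exact (congrArg Finset.val (Finset.map_univ_equiv σ)).symm
  refine ⟨t ∘ σ, ?_, ?_, hσ⟩
  · rw [← hperm, ← ht, Polynomial.aroots_def, ← Matrix.charpoly_map]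
  · rw [secondCompound_eq_compoundTwo, Polynomial.aroots_def, ← Matrix.charpoly_map,
      ← Matrix.compoundTwo_map, ht2]
    exact map_mul_indexPair_eq_of_map_eq _ _ hperm

theorem theorem15 (n : ℕ) (hn : 2 ≤ n) (A : Matrix (Fin n) (Fin n) ℝ)
    (J : Set (Fin n)) (J' : Set (IndexPair n))
    (hA : JSignSymmetric A J) (hAirr : IrreducibleMatrix A)
    (hA2 : JSignSymmetric (secondCompound A) J')
    (hA2irr : IrreducibleMatrix (secondCompound A)) :
    (TransitiveSet (WHat J J') →
      imprimitivityIndex (Matrix.toLin' A) = 1 ∧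
      ∃ (ev : Fin n → ℂ) (ev1 ev2 : ℝ),
        -- `ev` lists all eigenvalues, with multiplicity, in decreasing order of the modulus
        eigenvaluesOf (Matrix.toLin' A) = Finset.univ.val.map ev ∧
        (∀ i j : Fin n, i ≤ j → ‖ev j‖ ≤ ‖ev i‖) ∧
        -- the first two are positive and simple
        ev ⟨0, by omega⟩ = (ev1 : ℂ) ∧ ev ⟨1, by omega⟩ = (ev2 : ℂ) ∧
        rho (Matrix.toLin' A) = ev1 ∧ ev2 < ev1 ∧ 0 < ev2 ∧
        IsSimpleEigenvalue (Matrix.toLin' A) (ev1 : ℂ) ∧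
        IsSimpleEigenvalue (Matrix.toLin' A) (ev2 : ℂ) ∧
        -- the primitive exterior square
        (imprimitivityIndex (exteriorSquare (Matrix.toLin' A)) = 1 →
          ∀ i : Fin n, i.val ≠ 1 → ‖ev i‖ ≠ ev2) ∧
        -- the imprimitive exterior square
        (1 < imprimitivityIndex (exteriorSquare (Matrix.toLin' A)) →
          imprimitivityIndex (exteriorSquare (Matrix.toLin' A)) + 1 ≤ n ∧
          (∀ i : Fin n, ‖ev i‖ = ev2 ↔
            1 ≤ i.val ∧ i.val ≤ imprimitivityIndex (exteriorSquare (Matrix.toLin' A))) ∧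
          (∀ i : Fin n, ‖ev i‖ = ev2 → IsSimpleEigenvalue (Matrix.toLin' A) (ev i)) ∧
          (∀ z : ℂ, (∃ i : Fin n, ‖ev i‖ = ev2 ∧ ev i = z) ↔
            z ^ imprimitivityIndex (exteriorSquare (Matrix.toLin' A)) =
              (ev2 : ℂ) ^ imprimitivityIndex (exteriorSquare (Matrix.toLin' A))))) ∧
    (¬ TransitiveSet (WHat J J') →
      imprimitivityIndex (Matrix.toLin' A) = 3 ∧
      imprimitivityIndex (exteriorSquare (Matrix.toLin' A)) = 3 ∧
      (∀ z : ℂ, z ∈ eigenvaluesOf (Matrix.toLin' A) → ‖z‖ = rho (Matrix.toLin' A) →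
        IsSimpleEigenvalue (Matrix.toLin' A) z) ∧
      (∀ z : ℂ, (z ∈ eigenvaluesOf (Matrix.toLin' A) ∧ ‖z‖ = rho (Matrix.toLin' A)) ↔
        z ^ 3 = (rho (Matrix.toLin' A) : ℂ) ^ 3)) := by
  obtain ⟨ev, hev, hev2, hsort⟩ := exists_sorted_eigenvalues A
  obtain ⟨r, u, hu, hAu, -, hper, hdiag⟩ := hA.perron_frobenius hAirr
  obtain ⟨s, y, hy, -, hys, hper2, -⟩ := hA2.perron_frobenius hA2irr
  have hE : eigenvaluesOf (Matrix.toLin' A) = Finset.univ.val.map ev := by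
    rw [eigenvaluesOf, Matrix.charpoly_toLin', hev]
  have hE2 : eigenvaluesOf (exteriorSquare (Matrix.toLin' A)) =
      (Finset.univ : Finset (IndexPair n)).val.map (fun p => ev p.1.1 * ev p.1.2) := by
    rw [eigenvaluesOf, charpoly_exteriorSquare, hev2]
  rw [hev] at hper hdiag
  rw [hev2] at hper2
  have hrho : rho (Matrix.toLin' A) = r := rho_eq_of_isPeripherallyCyclic (by rwa [hE])
  have hrho2 : rho (exteriorSquare (Matrix.toLin' A)) = s :=
    rho_eq_of_isPeripherallyCyclic (by rwa [hE2])
  simp only [imprimitivityIndex, IsSimpleEigenvalue, hrho, hrho2, hE, hE2]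
  have hcases := hper.card_filter_eq_one_or_three hper2
  refine ⟨fun hW => ?_, fun hW => ?_⟩
  · have hprim : ((Finset.univ.val.map ev).filter fun w => ‖w‖ = r).card = 1 := by
      -- With three peripheral eigenvalues, `r` times a primitive cube root of unity is one of them,
      -- but a positive diagonal entry admits only `r`.
      refine hcases.resolve_right fun h3 => ?_
      have hω := Complex.isPrimitiveRoot_exp 3 (by norm_num)
      have hmem := (hper.mem_iff (r * Complex.exp (2 * Real.pi * Complex.I / (3 : ℕ)))).2 (by
        rw [h3.1, mul_pow, hω.pow_eq_one, mul_one])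
      have h4 := hdiag (exists_diag_pos_of_transitiveSet hn hA hAirr hA2 hW) _ hmem.1 hmem.2
      have hr0 : (r : ℂ) ≠ 0 := by exact_mod_cast hper.pos.ne'
      exact hω.ne_one (by norm_num) (mul_left_cancel₀ hr0 (h4.trans (mul_one _).symm))
    obtain ⟨l, hs, h0, h1, hl0, hlr, hcount, hkn, hmod, hroots⟩ :=
      hper.second_eigenvalue hn hsort hper2 hprim
    have hl1 : ‖ev ⟨1, by omega⟩‖ = l := by rw [h1]; simp [hl0.le]
    refine ⟨hprim, ev, r, l, rfl, fun i j hij => (hsort i j hij).elim le_of_lt fun h => h.1.le,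
      h0, h1, rfl, hlr, hl0, ?_, ?_, ?_, ?_⟩
    · exact hper.count_eq_one _ hper.mem (by simp [hper.pos.le])
    · rw [← h1]
      exact hcount _ hl1
    · intro hk i hi hil
      have := (hmod i).1 hil
      rw [hk] at this
      exact hi (le_antisymm this.2 this.1)
    · exact fun _ => ⟨hkn, hmod, hcount, hroots⟩
  · have h3 : ((Finset.univ.val.map ev).filter fun w => ‖w‖ = r).card ≠ 1 := by
      intro hprim
      obtain ⟨l, hs, h0, h1, hl0, hlr, -⟩ := hper.second_eigenvalue hn hsort hper2 hprim
      refine hW (transitiveSet_WHat_of_eigenvalue (by omega) hu hAu hy (hs ▸ hys) ?_ hlr.ne)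
      rw [hev, ← h1]
      exact Multiset.mem_map_of_mem ev (Finset.mem_univ_val _)
    obtain ⟨h3, h3'⟩ := hcases.resolve_left h3
    have hmem := hper.mem_iff
    rw [h3] at hmem
    exact ⟨h3, h3', hper.count_eq_one, hmem⟩
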